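/- Let $H$ be a real Hilbert space, let $X\subset H$ be nonempty, closed and convex, let $A:H\to 2^H$ be maximally monotone, let $B_1:H\to H$ be $\beta$-cocoercive for some $\beta>0$ (that is, $\langle x-y\mid B_1x-B_1y\rangle\ge\beta\|B_1x-B_1y\|^2$ for all $x,y$), let $B_2:H\to H$ be monotone and $L$-Lipschitzian for some $L>0$, and let $B_3:H\to 2^H$ be maximally monotone, single valued and continuous in $\operatorname{dom}A\cup X\subset\operatorname{dom}B_3$. Assume that $A+B_3$ is maximally monotone and that the problem $$\text{find } x\in X \text{ such that } 0\in Ax+B_1x+B_2x+B_3x$$ has a solution. Suppose that one of the following holds: (1) $X\subset\operatorname{dom}A$; (2) $\overline{\operatorname{dom}}\,A\subset\operatorname{dom}B_3$ and $B_3$ is locally bounded in $\operatorname{dom}B_3$ (every point of $\operatorname{dom}B_3$ is the centre of a ball with bounded image under $B_3$); (3) $\overline{\operatorname{dom}}\,A\subset\operatorname{int}\operatorname{dom}B_3$. Let $\varepsilon\in\,]0,1[$, $\rho=\min\{2\beta\varepsilon,\sqrt{1-\varepsilon}/L\}$, $\sigma\in\,]0,1[$, $\theta\in\,]0,\sqrt{1-\varepsilon}-L\rho\sigma[$,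 and $z_0\in\operatorname{dom}B_3$. With $J_{\gamma A}=(\mathrm{Id}+\gamma A)^{-1}$ and $P_X$ the projection onto $X$, consider the recurrence $$x_n=J_{\gamma_nA}\big(z_n-\gamma_n(B_1+B_2+B_3)z_n\big),\qquad z_{n+1}=P_X\big(x_n+\gamma_n(B_2+B_3)z_n-\gamma_n(B_2+B_3)x_n\big)\qquad(n\in\mathbb N),$$ where $\gamma_n$ is the largest $\gamma\in\{\rho\sigma,\rho\sigma^2,\rho\sigma^3,\dots\}$ satisfying $$\gamma\big\|B_3z_n-B_3J_{\gamma A}\big(z_n-\gamma(B_1+B_2+B_3)z_n\big)\big\|\le\theta\big\|z_n-J_{\gamma A}\big(z_n-\gamma(B_1+B_2+B_3)z_n\big)\big\|,$$ and where, if $B_3z_0$ has more than one element, $B_3z_0$ stands for one fixed element of it, chosen arbitrarily. (a) If (2) or (3) holds, or if $z_0\in\operatorname{dom}A$, then the iteration is well defined: for every choice of the element of $B_3z_0$, there is exactly one family of sequences $(z_n),(x_n),(\gamma_n)$ starting at $z_0$ that satisfies the recurrence. (b) Let $(z_n),(x_n),(\gamma_n)$ satisfy the recurrence, starting at $z_0$,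 and assume that at least one of the following holds: (i) $\liminf_{n\to\infty}\gamma_n>0$; (ii) for every weakly compact $K\subset\overline{\operatorname{conv}}(\operatorname{dom}A\cup X)$, $B_3$ is uniformly continuous in $K$ (that is, on $K\cap\operatorname{dom}B_3$ the operator $B_3$ is single valued and uniformly continuous). Then $(z_n)_{n\in\mathbb N}$ converges weakly to a solution of the problem. -/

import Mathlib

open scoped Pointwise

/-- The domain of a set-valued operator. -/
def opDom {H : Type*} (A : H → Set H) : Set H := {x | (A x).Nonempty}

/-- Maximal monotonicity of a set-valued operator: `(x, u)` belongs to the graph of `A` if and only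
if it is monotonically related to every point of the graph of `A`. (The direction `→` is
monotonicity, the direction `←` is maximality.) -/
def IsMaximallyMonotone {H : Type*} [NormedAddCommGroup H] [InnerProductSpace ℝ H]
    (A : H → Set H) : Prop :=
  ∀ x u, u ∈ A x ↔ ∀ y, ∀ v ∈ A y, 0 ≤ inner ℝ (x - y) (u - v)

/-- Monotonicity of a single-valued operator. -/
def IsMonotoneMap {H : Type*} [NormedAddCommGroup H] [InnerProductSpace ℝ H]
    (B : H → H) : Prop :=
  ∀ x y, 0 ≤ inner ℝ (x - y) (B x - B y)

/-- `β`-cocoercivity of an everywhere defined single-valued operator. -/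
def IsCocoercive {H : Type*} [NormedAddCommGroup H] [InnerProductSpace ℝ H]
    (β : ℝ) (B : H → H) : Prop :=
  ∀ x y, β * ‖B x - B y‖ ^ 2 ≤ inner ℝ (x - y) (B x - B y)

/-- `B` is single valued and continuous in `D` (in particular `D ⊆ dom B`); continuity is that of
the restriction to `D`. -/
def IsSingleValuedContinuousIn {H : Type*} [TopologicalSpace H] (B : H → Set H) (D : Set H) :
    Prop :=
  ∃ f : H → H, (∀ x ∈ D, B x = {f x}) ∧ ContinuousOn f D

/-- `B` is uniformly continuous in `K`: on the part of `K` where `B` is defined, it is single valued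
and uniformly continuous. -/
def IsUniformlyContinuousIn {H : Type*} [UniformSpace H] (B : H → Set H) (K : Set H) : Prop :=
  ∃ f : H → H, (∀ x ∈ K ∩ opDom B, B x = {f x}) ∧ UniformContinuousOn f (K ∩ opDom B)

/-- `B` is locally bounded at every point of `D`: the image of some ball centred there is bounded. -/
def IsLocallyBoundedIn {H : Type*} [PseudoMetricSpace H] (B : H → Set H) (D : Set H) : Prop :=
  ∀ x ∈ D, ∃ δ > 0, Bornology.IsBounded (⋃ y ∈ Metric.ball x δ, B y)

/-- The resolvent `J_A = (Id + A)⁻¹`, as a set-valued operator: `x ∈ J_A u` iff `u ∈ x + A x`. -/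
def resolventOp {H : Type*} [AddCommGroup H] (A : H → Set H) (u : H) : Set H :=
  {x | u - x ∈ A x}

/-- `p` is the projection of `u` onto `X` (a nearest point of `X`). -/
def IsProjectionOnto {H : Type*} [NormedAddCommGroup H] (X : Set H) (u p : H) : Prop :=
  p ∈ X ∧ ∀ q ∈ X, ‖u - p‖ ≤ ‖u - q‖

/-- `x` solves the inclusion `0 ∈ A x + B₁ x + B₂ x + B₃ x` with the constraint `x ∈ X`. -/
def IsInclusionSolution {H : Type*} [AddCommGroup H] (X : Set H) (A : H → Set H)
    (B₁ B₂ : H → H) (B₃ : H → Set H) (x : H) : Prop :=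
  x ∈ X ∧ (0 : H) ∈ A x + {B₁ x} + {B₂ x} + B₃ x

/-- The line search inequality at the point `z`, with `b ∈ B₃ z`, for the trial step size `γ`:
with `x = J_{γA} (z - γ (B₁ z + B₂ z + b))`, one has `γ ‖B₃ z - B₃ x‖ ≤ θ ‖z - x‖`. -/
def LineSearchTest {H : Type*} [NormedAddCommGroup H] [InnerProductSpace ℝ H]
    (A : H → Set H) (B₁ B₂ : H → H) (B₃ : H → Set H) (θ : ℝ) (z b : H) (γ : ℝ) : Prop :=
  ∃ x ∈ resolventOp (fun w => γ • A w) (z - γ • (B₁ z + B₂ z + b)),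
    ∃ c ∈ B₃ x, γ * ‖b - c‖ ≤ θ * ‖z - x‖

/-- The sequences generated by the forward-backward-half-forward iteration: the iterates `z n`, the
auxiliary points `x n`, the values `b n` and `c n` of `B₃` at `z n` and at `x n`, and the step
sizes `γ n`. -/
structure FBHFSequences (H : Type*) where
  z : ℕ → H
  x : ℕ → H
  b : ℕ → H
  c : ℕ → H
  γ : ℕ → ℝ

/-- The recurrence of the forward-backward-half-forward iteration with backtracking:
`γ n` is the largest element of `{ρσ, ρσ², ρσ³, …}` that passes the line search test,
`x n = J_{γ n A} (z n - γ n (B₁ + B₂ + B₃) (z n))` and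
`z (n + 1) = P_X (x n + γ n (B₂ + B₃) (z n) - γ n (B₂ + B₃) (x n))`. -/
structure IsFBHF {H : Type*} [NormedAddCommGroup H] [InnerProductSpace ℝ H]
    (X : Set H) (A : H → Set H) (B₁ B₂ : H → H) (B₃ : H → Set H) (ρ σ θ : ℝ)
    (s : FBHFSequences H) : Prop where
  b_mem : ∀ n, s.b n ∈ B₃ (s.z n)
  step_size : ∀ n, IsGreatest
    {γ : ℝ | (∃ k : ℕ, 1 ≤ k ∧ γ = ρ * σ ^ k) ∧ LineSearchTest A B₁ B₂ B₃ θ (s.z n) (s.b n) γ}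
    (s.γ n)
  x_mem : ∀ n, s.x n ∈ resolventOp (fun w => s.γ n • A w)
    (s.z n - s.γ n • (B₁ (s.z n) + B₂ (s.z n) + s.b n))
  c_mem : ∀ n, s.c n ∈ B₃ (s.x n)
  z_succ : ∀ n, IsProjectionOnto X
    (s.x n + s.γ n • (B₂ (s.z n) + s.b n) - s.γ n • (B₂ (s.x n) + s.c n)) (s.z (n + 1))

/-!
Two facts carry the argument.

*The line search terminates.* As `γ ↓ 0`, the points `J_{γA} (z - γ w)` converge to a point of the
closure of `dom A` and the quotients `‖z - J_{γA} (z - γ w)‖ / γ` increase. If every trial step were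
rejected, these quotients would be controlled by `‖B₃ z - B₃ J_{γA} (z - γ w)‖`. Continuity of `B₃`
excludes this for `z ∈ dom A`. For `z ∉ dom A` the quotients are unbounded, while `B₃` is bounded
near the limit, either by assumption or because a maximally monotone operator is locally bounded in
the interior of its domain (`exists_lineSearchTest`). The sequences are then built by recursion, and
they are unique because resolvents and projections are.

*The iterates are Fejér monotone.* For a solution `p`, monotonicity of `A`, `B₂`, `B₃`,
cocoercivity of `B₁` and the line search inequality give
`‖z (n + 1) - p‖² ≤ ‖z n - p‖² - η ‖z n - x n‖²` with `η > 0` (`IsFBHF.norm_sub_sq_le`), so that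
`z n - x n → 0`. By Opial's lemma (`exists_tendsto_inner_of_opial`) it remains to see that the weak
cluster points are solutions. The graph of `A + B₁ + B₂ + B₃` is closed for weak convergence of the
points and strong convergence of the values, so that it is enough to find points near `z n` with
vanishing residuals (`isInclusionSolution_of_tendsto`). Where the step sizes stay away from `0`, the
points `x n` serve. Elsewhere a trial step was rejected, and the resolvent at the rejected step
`γ n / σ` serves: rejection and the uniform continuity of `B₃` force its residual to vanish.

Minty's theorem on the resolvent is proved by means of the Fitzpatrick function, and weak limits are
taken along ultrafilters, where bounded families always converge.
-/

/-! ### Weak convergence in a Hilbert space -/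

section

open Filter Topology

variable {H : Type*} [NormedAddCommGroup H] [InnerProductSpace ℝ H]

theorem tendsto_toWeakSpace_iff [CompleteSpace H] {ι : Type*} {l : Filter ι} {u : ι → H} {a : H} :
    Tendsto (fun i => toWeakSpace ℝ H (u i)) l (𝓝 (toWeakSpace ℝ H a)) ↔
      ∀ y, Tendsto (fun i => inner ℝ (u i) y) l (𝓝 (inner ℝ a y)) := by
  have hinj : Function.Injective (topDualPairing ℝ H).flip := by
    intro x y hxy
    refine ext_inner_left ℝ fun v => ?_
    simpa using LinearMap.congr_fun hxy (InnerProductSpace.toDual ℝ H v)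
  refine (WeakBilin.tendsto_iff_forall_eval_tendsto (topDualPairing ℝ H).flip hinj).trans
    ⟨fun h y => ?_, fun h φ => ?_⟩
  · simp only [fun z => real_inner_comm y z]
    exact h (InnerProductSpace.toDual ℝ H y)
  · have := h ((InnerProductSpace.toDual ℝ H).symm φ)
    simp only [real_inner_comm ((InnerProductSpace.toDual ℝ H).symm φ),
      InnerProductSpace.toDual_symm_apply] at this
    exact this

/-- Weak compactness of bounded sets, in the form used throughout: along an ultrafilter, a bounded
family converges weakly. It is the Banach–Alaoglu theorem, transported by the Riesz isometry. -/
theorem Ultrafilter.exists_tendsto_inner [CompleteSpace H] {ι : Type*} (U : Ultrafilter ι)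
    {u : ι → H} {R : ℝ} (hu : ∀ᶠ i in U, ‖u i‖ ≤ R) :
    ∃ a, ∀ y, Tendsto (fun i => inner ℝ (u i) y) U (𝓝 (inner ℝ a y)) := by
  let φ : ι → WeakDual ℝ H := fun i =>
    StrongDual.toWeakDual (InnerProductSpace.toDual ℝ H (u i))
  have hK := WeakDual.isCompact_closedBall (0 : StrongDual ℝ H) R
  have hmem : ∀ᶠ i in U, φ i ∈ WeakDual.toStrongDual ⁻¹' Metric.closedBall 0 R := by
    filter_upwards [hu] with i hi
    simpa [φ] using hi
  obtain ⟨ψ, -, hψ⟩ := isCompact_iff_ultrafilter_le_nhds.1 hK (U.map φ) (le_principal_iff.2 hmem)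
  refine ⟨(InnerProductSpace.toDual ℝ H).symm (WeakDual.toStrongDual ψ), fun y => ?_⟩
  have h : Tendsto φ U (𝓝 ψ) := hψ
  have := ((WeakDual.eval_continuous y).tendsto ψ).comp h
  simpa [φ, Function.comp_def] using this

theorem exists_norm_sub_forall_inner_nonpos [CompleteSpace H] {C : Set H} (hne : C.Nonempty)
    (hcl : IsClosed C) (hc : Convex ℝ C) (a : H) :
    ∃ p ∈ C, ∀ q ∈ C, inner ℝ (a - p) (q - p) ≤ 0 := by
  obtain ⟨p, hp, h⟩ := exists_norm_eq_iInf_of_complete_convex hne hcl.isComplete hc a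
  exact ⟨p, hp, (norm_eq_iInf_iff_real_inner_le_zero hc hp).1 h⟩

theorem Convex.mem_of_tendsto_inner [CompleteSpace H] {C : Set H} (hc : Convex ℝ C)
    (hcl : IsClosed C) {ι : Type*} {l : Filter ι} [l.NeBot] {u : ι → H} {a : H}
    (hu : ∀ᶠ i in l, u i ∈ C)
    (ha : ∀ y, Tendsto (fun i => inner ℝ (u i) y) l (𝓝 (inner ℝ a y))) : a ∈ C := by
  obtain ⟨p, hp, h⟩ := exists_norm_sub_forall_inner_nonpos
    (let ⟨i, hi⟩ := hu.exists; ⟨u i, hi⟩) hcl hc a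
  have h1 : inner ℝ a (a - p) ≤ inner ℝ p (a - p) := by
    refine le_of_tendsto (ha (a - p)) ?_
    filter_upwards [hu] with i hi
    have := h _ hi
    rw [real_inner_comm, inner_sub_left] at this
    linarith
  rw [← sub_nonpos, ← inner_sub_left, real_inner_self_nonpos, sub_eq_zero] at h1
  exact h1 ▸ hp

theorem isCompact_toWeakSpace_image [CompleteSpace H] {C : Set H} (hc : Convex ℝ C)
    (hcl : IsClosed C) {R : ℝ} (hb : ∀ x ∈ C, ‖x‖ ≤ R) :
    IsCompact (toWeakSpace ℝ H '' C) := by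
  rw [isCompact_iff_ultrafilter_le_nhds]
  intro U hU
  have hmem : ∀ᶠ w in (U : Filter (WeakSpace ℝ H)), (toWeakSpace ℝ H).symm w ∈ C := by
    filter_upwards [le_principal_iff.1 hU] with w hw
    obtain ⟨x, hx, rfl⟩ := hw
    simpa using hx
  obtain ⟨a, ha⟩ := U.exists_tendsto_inner (hmem.mono fun w hw => hb _ hw)
  refine ⟨toWeakSpace ℝ H a, ⟨a, hc.mem_of_tendsto_inner hcl hmem ha, rfl⟩, ?_⟩
  simpa using! tendsto_toWeakSpace_iff.2 ha

theorem tendsto_inner_of_weak_of_strong {ι : Type*} {l : Filter ι} {u e : ι → H} {a b : H} {R : ℝ}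
    (hu : ∀ᶠ i in l, ‖u i‖ ≤ R)
    (ha : ∀ y, Tendsto (fun i => inner ℝ (u i) y) l (𝓝 (inner ℝ a y)))
    (he : Tendsto e l (𝓝 b)) :
    Tendsto (fun i => inner ℝ (u i) (e i)) l (𝓝 (inner ℝ a b)) := by
  have h0 : Tendsto (fun i => inner ℝ (u i) (e i - b)) l (𝓝 0) := by
    have h1 : Tendsto (fun i => R * ‖e i - b‖) l (𝓝 0) := by
      simpa using (tendsto_iff_norm_sub_tendsto_zero.1 he).const_mul R
    refine squeeze_zero_norm' ?_ h1
    filter_upwards [hu] with i hi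
    exact (norm_inner_le_norm _ _).trans (by gcongr)
  simpa [← inner_add_right] using (h0.add (ha b))

/-- **Opial's lemma** for a bounded family along a filter: if the distances to the points of `S`
converge and the weak cluster points, obtained along ultrafilters, lie in `S`, then the whole family
converges weakly to a point of `S`. -/
theorem exists_tendsto_inner_of_opial [CompleteSpace H] {ι : Type*} {l : Filter ι} [l.NeBot]
    {u : ι → H} {R : ℝ} (hu : ∀ᶠ i in l, ‖u i‖ ≤ R) {S : Set H}
    (hdist : ∀ p ∈ S, ∃ d : ℝ, Tendsto (fun i => ‖u i - p‖ ^ 2) l (𝓝 d))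
    (hS : ∀ U : Ultrafilter ι, ↑U ≤ l → ∀ a,
      (∀ y, Tendsto (fun i => inner ℝ (u i) y) U (𝓝 (inner ℝ a y))) → a ∈ S) :
    ∃ a ∈ S, ∀ y, Tendsto (fun i => inner ℝ (u i) y) l (𝓝 (inner ℝ a y)) := by
  have hlim : ∀ U : Ultrafilter ι, ↑U ≤ l → ∃ a ∈ S,
      ∀ y, Tendsto (fun i => inner ℝ (u i) y) U (𝓝 (inner ℝ a y)) := fun U hU => by
    obtain ⟨a, ha⟩ := U.exists_tendsto_inner (hU hu)
    exact ⟨a, hS U hU a ha, ha⟩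
  obtain ⟨a, haS, ha⟩ := hlim (Ultrafilter.of l) (Ultrafilter.of_le l)
  refine ⟨a, haS, fun y => tendsto_iff_ultrafilter _ _ _ |>.2 fun U hU => ?_⟩
  obtain ⟨b, hbS, hb⟩ := hlim U hU
  obtain ⟨d, hd⟩ := hdist a haS
  obtain ⟨d', hd'⟩ := hdist b hbS
  -- The difference of the squared distances to `a` and `b` is affine in `u i`, so that its limit
  -- can be evaluated along either ultrafilter.
  have hdiff : ∀ i, ‖u i - a‖ ^ 2 - ‖u i - b‖ ^ 2
      = 2 * inner ℝ (u i) (b - a) + (‖a‖ ^ 2 - ‖b‖ ^ 2) := fun i => by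
    rw [norm_sub_sq_real, norm_sub_sq_real, inner_sub_right]; ring
  have key : Tendsto (fun i => 2 * inner ℝ (u i) (b - a) + (‖a‖ ^ 2 - ‖b‖ ^ 2)) l
      (𝓝 (d - d')) := by simpa only [hdiff] using hd.sub hd'
  have e1 := tendsto_nhds_unique (key.mono_left (Ultrafilter.of_le l))
    (((ha (b - a)).const_mul 2).add_const _)
  have e2 := tendsto_nhds_unique (key.mono_left hU) (((hb (b - a)).const_mul 2).add_const _)
  have e3 : inner ℝ (b - a) (b - a) = (0 : ℝ) := by
    rw [inner_sub_left]; linarith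
  rw [inner_self_eq_zero, sub_eq_zero] at e3
  exact e3 ▸ hb y

end

/-! ### Maximally monotone operators -/

section

open Filter Topology

variable {H : Type*} [NormedAddCommGroup H] [InnerProductSpace ℝ H]

theorem IsMaximallyMonotone.inner_nonneg {A : H → Set H} (hA : IsMaximallyMonotone A) {x y u v : H}
    (hu : u ∈ A x) (hv : v ∈ A y) : 0 ≤ inner ℝ (x - y) (u - v) :=
  (hA x u).1 hu y v hv

/-- The graph of a maximally monotone operator is closed for strong convergence of the points and
weak convergence of the values. -/
theorem IsMaximallyMonotone.mem_of_strong_of_weak {A : H → Set H} (hA : IsMaximallyMonotone A)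
    {ι : Type*} {l : Filter ι} [l.NeBot] {x u : ι → H} {a b : H} {R : ℝ}
    (hxu : ∀ᶠ i in l, u i ∈ A (x i)) (hR : ∀ᶠ i in l, ‖u i‖ ≤ R)
    (hx : Tendsto x l (𝓝 a))
    (hu : ∀ y, Tendsto (fun i => inner ℝ (u i) y) l (𝓝 (inner ℝ b y))) : b ∈ A a := by
  refine (hA a b).2 fun y v hv => ?_
  have h1 := (tendsto_inner_of_weak_of_strong hR hu (hx.sub_const y)).sub
    ((tendsto_const_nhds (x := v)).inner (𝕜 := ℝ) (hx.sub_const y))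
  rw [real_inner_comm, inner_sub_left]
  refine ge_of_tendsto h1 ?_
  filter_upwards [hxu] with i hi
  rw [← inner_sub_left, real_inner_comm]
  exact hA.inner_nonneg hi hv

/-- A closed convex set `G ⊆ E × ℝ`, thought of as the epigraph of a function `F`, contains a
minimizer of `F + ‖·‖² / 2` as soon as this function is bounded below on it; the conclusion is the
optimality condition. -/
theorem exists_forall_epigraph_le {E : Type*} [NormedAddCommGroup E] [InnerProductSpace ℝ E]
    [CompleteSpace E] {G : Set (E × ℝ)} (hne : G.Nonempty) (hcl : IsClosed G) (hc : Convex ℝ G)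
    {m₀ : ℝ} (hm₀ : ∀ g ∈ G, m₀ ≤ g.2 + ‖g.1‖ ^ 2 / 2) :
    ∃ g ∈ G, ∀ h ∈ G, g.2 - inner ℝ g.1 (h.1 - g.1) ≤ h.2 := by
  set Φ : E × ℝ → ℝ := fun g => g.2 + ‖g.1‖ ^ 2 / 2 with hΦ
  have hΦc : Continuous Φ := by fun_prop
  have hbdd : BddBelow (Φ '' G) := ⟨m₀, by rintro _ ⟨g, hg, rfl⟩; exact hm₀ g hg⟩
  set m := sInf (Φ '' G) with hm
  have hmle : ∀ g ∈ G, m ≤ Φ g := fun g hg => csInf_le hbdd ⟨g, hg, rfl⟩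
  obtain ⟨w, -, hw, hwm⟩ := exists_seq_tendsto_sInf (hne.image Φ) hbdd
  choose g hgG hgw using hwm
  have hlim : Tendsto (fun n => Φ (g n)) atTop (𝓝 m) := by simpa only [hgw] using hw
  -- By strong convexity, the first components of a minimizing sequence form a Cauchy sequence.
  have hpar : ∀ i j, ‖(g i).1 - (g j).1‖ ^ 2 ≤ 4 * (Φ (g i) - m) + 4 * (Φ (g j) - m) := by
    intro i j
    have hmid := hmle _ (hc (hgG i) (hgG j) (a := 1 / 2) (b := 1 / 2) (by norm_num) (by norm_num)
      (by norm_num))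
    have e : ‖(1 / 2 : ℝ) • (g i).1 + (1 / 2 : ℝ) • (g j).1‖ ^ 2
        = ‖(g i).1‖ ^ 2 / 2 + ‖(g j).1‖ ^ 2 / 2 - ‖(g i).1 - (g j).1‖ ^ 2 / 4 := by
      rw [norm_add_sq_real, norm_sub_sq_real, norm_smul, norm_smul, real_inner_smul_left,
        real_inner_smul_right]
      norm_num
      ring
    simp only [hΦ, Prod.fst_add, Prod.snd_add, Prod.smul_fst, Prod.smul_snd, smul_eq_mul, e]
      at hmid ⊢
    linarith
  have hcau : CauchySeq fun n => (g n).1 := by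
    rw [Metric.cauchySeq_iff']
    intro δ hδ
    have hev : ∀ᶠ n in atTop, Φ (g n) < m + δ ^ 2 / 8 :=
      hlim.eventually_lt_const (by have := pow_pos hδ 2; linarith)
    obtain ⟨N, hN⟩ := eventually_atTop.1 hev
    refine ⟨N, fun n hn => ?_⟩
    rw [dist_eq_norm]
    refine lt_of_pow_lt_pow_left₀ 2 hδ.le ?_
    have := hpar n N
    have := hN n hn
    have := hN N le_rfl
    linarith
  obtain ⟨p, hp⟩ := cauchySeq_tendsto_of_complete hcau
  have hg2 : Tendsto (fun n => (g n).2) atTop (𝓝 (m - ‖p‖ ^ 2 / 2)) := by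
    have := hlim.sub ((hp.norm.pow 2).div_const 2)
    simpa [hΦ] using this
  have hpG : (p, m - ‖p‖ ^ 2 / 2) ∈ G :=
    hcl.mem_of_tendsto (hp.prodMk_nhds hg2) (Eventually.of_forall hgG)
  refine ⟨_, hpG, fun h hh => ?_⟩
  -- Compare with the points of the segment towards `h`, and let them tend to the minimizer.
  have hseg : ∀ t ∈ Set.Ioo (0 : ℝ) 1,
      0 ≤ (h.2 - (m - ‖p‖ ^ 2 / 2) + inner ℝ p (h.1 - p)) + t * (‖h.1 - p‖ ^ 2 / 2) := by
    intro t ht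
    have hmem := hmle _ (hc hpG hh (a := 1 - t) (b := t) (by linarith [ht.2]) ht.1.le (by ring))
    have e : (1 - t) • p + t • h.1 = p + t • (h.1 - p) := by module
    simp only [hΦ, Prod.fst_add, Prod.snd_add, Prod.smul_fst, Prod.smul_snd, smul_eq_mul, e,
      norm_add_sq_real, real_inner_smul_right, norm_smul, mul_pow, Real.norm_eq_abs, sq_abs]
      at hmem
    refine nonneg_of_mul_nonneg_right (a := t) ?_ ht.1
    linarith
  have hlim0 : Tendsto (fun t : ℝ => (h.2 - (m - ‖p‖ ^ 2 / 2) + inner ℝ p (h.1 - p))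
      + t * (‖h.1 - p‖ ^ 2 / 2)) (𝓝[>] 0)
      (𝓝 ((h.2 - (m - ‖p‖ ^ 2 / 2) + inner ℝ p (h.1 - p)) + 0 * (‖h.1 - p‖ ^ 2 / 2))) :=
    (Continuous.tendsto (by fun_prop) _).mono_left nhdsWithin_le_nhds
  have := ge_of_tendsto hlim0
    (by filter_upwards [Ioo_mem_nhdsGT (zero_lt_one' ℝ)] with t ht using hseg t ht)
  linarith

theorem IsMaximallyMonotone.exists_mem {A : H → Set H} (hA : IsMaximallyMonotone A) :
    ∃ x u, u ∈ A x := by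
  by_contra! h
  exact h 0 0 ((hA 0 0).2 fun y v hv => (h y v hv).elim)

/-- **Minty's theorem** at the origin: `0` lies in the range of `Id + A`. Following Simons and
Zălinescu, it results from minimizing `F + ‖·‖² / 2` on `H × H`, where
`F (x, u) = sup {⟪x, v⟫ + ⟪y, u⟫ - ⟪y, v⟫ | v ∈ A y}` is the Fitzpatrick function of `A`. -/
theorem IsMaximallyMonotone.exists_neg_mem [CompleteSpace H] {A : H → Set H}
    (hA : IsMaximallyMonotone A) : ∃ x, -x ∈ A x := by
  -- The epigraph of the Fitzpatrick function.
  let G : Set (WithLp 2 (H × H) × ℝ) := {g | ∀ y, ∀ v ∈ A y,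
    inner ℝ g.1.fst v + inner ℝ y g.1.snd - inner ℝ y v ≤ g.2}
  have hle : ∀ g ∈ G, inner ℝ g.1.fst g.1.snd ≤ g.2 := by
    intro g hg
    by_cases hmem : g.1.snd ∈ A g.1.fst
    · have := hg _ _ hmem
      linarith
    · rw [hA] at hmem
      push Not at hmem
      obtain ⟨y, v, hv, hlt⟩ := hmem
      have := hg y v hv
      rw [inner_sub_left, inner_sub_right, inner_sub_right] at hlt
      linarith
  have hne : G.Nonempty := by
    obtain ⟨x, u, hu⟩ := hA.exists_mem
    refine ⟨(WithLp.toLp 2 (x, u), inner ℝ x u), fun y v hv => ?_⟩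
    have := hA.inner_nonneg hu hv
    rw [inner_sub_left, inner_sub_right, inner_sub_right] at this
    simp only [WithLp.toLp_fst, WithLp.toLp_snd]
    linarith
  have hcl : IsClosed G := by
    simp only [G, Set.ofPred_forall]
    refine isClosed_iInter fun y => isClosed_iInter fun v => isClosed_iInter fun _ =>
      isClosed_le ?_ ?_ <;> fun_prop
  have hc : Convex ℝ G := by
    intro g hg h hh a b ha hb hab y v hv
    have h1 := mul_le_mul_of_nonneg_left (hg y v hv) ha
    have h2 := mul_le_mul_of_nonneg_left (hh y v hv) hb
    simp only [Prod.fst_add, Prod.snd_add, Prod.smul_fst, Prod.smul_snd, smul_eq_mul,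
      WithLp.add_fst, WithLp.add_snd, WithLp.smul_fst, WithLp.smul_snd, inner_add_left,
      inner_add_right, real_inner_smul_left, real_inner_smul_right]
    have h3 : inner ℝ y v = a * inner ℝ y v + b * inner ℝ y v := by rw [← add_mul, hab, one_mul]
    linarith
  have hbd : ∀ g ∈ G, (0 : ℝ) ≤ g.2 + ‖g.1‖ ^ 2 / 2 := by
    intro g hg
    have h1 := hle g hg
    have h2 := norm_add_sq_real g.1.fst g.1.snd
    rw [WithLp.prod_norm_sq_eq_of_L2]
    nlinarith [sq_nonneg ‖g.1.fst + g.1.snd‖]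
  obtain ⟨g, hgG, hg⟩ := exists_forall_epigraph_le hne hcl hc hbd
  have key : ∀ y, ∀ v ∈ A y,
      ‖g.1.fst + g.1.snd‖ ^ 2 ≤ inner ℝ (-g.1.snd - y) (-g.1.fst - v) := by
    intro y v hv
    -- The point `(y, v)` of the graph lies in the epigraph with the value `⟪y, v⟫`.
    have h1 := hg (WithLp.toLp 2 (y, v), inner ℝ y v) (fun y' v' hv' => by
      have := hA.inner_nonneg hv hv'
      rw [inner_sub_left, inner_sub_right, inner_sub_right] at this
      simp only [WithLp.toLp_fst, WithLp.toLp_snd]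
      linarith)
    have h2 := hle g hgG
    simp only [WithLp.prod_inner_apply, WithLp.ofLp_fst, WithLp.ofLp_snd, inner_sub_right,
      real_inner_self_eq_norm_sq] at h1
    rw [norm_add_sq_real]
    simp only [inner_sub_left, inner_sub_right, inner_neg_left, inner_neg_right]
    rw [real_inner_comm g.1.fst g.1.snd] at *
    rw [real_inner_comm g.1.fst y] at *
    linarith
  have hmem : -g.1.fst ∈ A (-g.1.snd) :=
    (hA _ _).2 fun y v hv => (sq_nonneg _).trans (key y v hv)
  have h0 := key _ _ hmem
  rw [sub_self, inner_zero_left] at h0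
  have h1 : g.1.fst + g.1.snd = 0 := by
    rw [← norm_eq_zero]; exact pow_eq_zero_iff two_ne_zero |>.1 (le_antisymm h0 (sq_nonneg _))
  refine ⟨-g.1.snd, ?_⟩
  rwa [eq_neg_of_add_eq_zero_left h1] at hmem

/-- **Minty's theorem**: the resolvent of `γ A` is defined everywhere. -/
theorem IsMaximallyMonotone.exists_inv_smul_mem [CompleteSpace H] {A : H → Set H}
    (hA : IsMaximallyMonotone A) {γ : ℝ} (hγ : 0 < γ) (w : H) :
    ∃ x, γ⁻¹ • (w - x) ∈ A x := by
  have h : IsMaximallyMonotone fun x => {u | γ⁻¹ • (u + w) ∈ A x} := by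
    intro x u
    rw [Set.mem_ofPred_eq, hA]
    constructor
    · intro h y v hv
      have h1 := h y _ hv
      rw [← smul_sub, real_inner_smul_right, add_sub_add_right_eq_sub] at h1
      exact nonneg_of_mul_nonneg_right h1 (inv_pos.2 hγ)
    · intro h y v hv
      have h1 := h y (γ • v - w) (by
        rwa [Set.mem_ofPred_eq, sub_add_cancel, smul_smul, inv_mul_cancel₀ hγ.ne', one_smul])
      have e : γ⁻¹ • (u + w) - v = γ⁻¹ • (u - (γ • v - w)) := by
        rw [smul_sub, smul_sub, smul_smul, inv_mul_cancel₀ hγ.ne', smul_add]; module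
      rw [e, real_inner_smul_right]
      exact mul_nonneg (inv_pos.2 hγ).le h1
  obtain ⟨x, hx⟩ := h.exists_neg_mem
  exact ⟨x, by simpa [sub_eq_neg_add] using hx⟩

/-- The sum of a maximally monotone operator `T` and a Lipschitzian monotone map `C` is maximally
monotone; only the maximality at the value `0` is stated. A point `x` that is monotonically related
to the graph is compared with the fixed point `y` of `J_{τT} (x - τ C ·)`. -/
theorem IsMaximallyMonotone.neg_mem_of_forall_inner_nonneg [CompleteSpace H] {T : H → Set H}
    (hT : IsMaximallyMonotone T) {C : H → H} {K : ℝ}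
    (hCL : ∀ x y, ‖C x - C y‖ ≤ K * ‖x - y‖) {x : H}
    (hx : ∀ y, ∀ v ∈ T y, 0 ≤ inner ℝ (x - y) (-(v + C y))) : -C x ∈ T x := by
  have hK : 0 < 2 * (|K| + 1) := by positivity
  set τ : ℝ := (2 * (|K| + 1))⁻¹ with hτdef
  have hτ : 0 < τ := inv_pos.2 hK
  choose J hJ using fun w => hT.exists_inv_smul_mem hτ w
  have hJne : ∀ w w', ‖J w - J w'‖ ≤ ‖w - w'‖ := by
    intro w w'
    have h1 := hT.inner_nonneg (hJ w) (hJ w')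
    rw [← smul_sub, real_inner_smul_right] at h1
    have h2 := nonneg_of_mul_nonneg_right h1 (inv_pos.2 hτ)
    have e : w - J w - (w' - J w') = (w - w') - (J w - J w') := by abel
    rw [e, inner_sub_right, real_inner_self_eq_norm_sq] at h2
    have h3 := real_inner_le_norm (J w - J w') (w - w')
    rcases (norm_nonneg (J w - J w')).eq_or_lt with h0 | h0
    · rw [← h0]; exact norm_nonneg _
    · refine le_of_mul_le_mul_left ?_ h0
      linarith
  have hcontr : ContractingWith (1 / 2) fun y => J (x - τ • C y) := by
    refine ⟨by rw [← NNReal.coe_lt_coe]; norm_num, LipschitzWith.of_dist_le_mul fun y y' => ?_⟩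
    rw [dist_eq_norm, dist_eq_norm]
    refine (hJne _ _).trans ?_
    rw [sub_sub_sub_cancel_left, ← smul_sub, norm_smul, Real.norm_of_nonneg hτ.le]
    have h1 : ‖C y' - C y‖ ≤ (|K| + 1) * ‖y - y'‖ := by
      rw [norm_sub_rev y]
      refine (hCL y' y).trans (mul_le_mul_of_nonneg_right ?_ (norm_nonneg _))
      linarith [le_abs_self K]
    calc τ * ‖C y' - C y‖ ≤ τ * ((|K| + 1) * ‖y - y'‖) := by gcongr
      _ = ((1 / 2 : NNReal) : ℝ) * ‖y - y'‖ := by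
        rw [hτdef]; push_cast; field_simp
  obtain ⟨y, hy⟩ : ∃ y, J (x - τ • C y) = y :=
    have : Nonempty H := ⟨0⟩
    ⟨_, hcontr.fixedPoint_isFixedPt⟩
  have hmem := hJ (x - τ • C y)
  rw [hy] at hmem
  have e : τ⁻¹ • (x - τ • C y - y) = τ⁻¹ • (x - y) - C y := by
    rw [sub_right_comm, smul_sub, smul_smul, inv_mul_cancel₀ hτ.ne', one_smul]
  rw [e] at hmem
  have h1 := hx y _ hmem
  rw [sub_add_cancel, inner_neg_right, real_inner_smul_right, real_inner_self_eq_norm_sq] at h1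
  have h2 : ‖x - y‖ ^ 2 ≤ 0 := by
    have := inv_pos.2 hτ
    by_contra! hlt
    have := mul_pos this hlt
    linarith
  have h3 : x = y := by
    rw [← sub_eq_zero, ← norm_eq_zero]
    exact pow_eq_zero_iff two_ne_zero |>.1 (le_antisymm h2 (sq_nonneg _))
  subst h3
  simpa using hmem

/-- A maximally monotone operator is locally bounded in the interior of its domain (Rockafellar).
The values `v` near `x`, divided by `1 + ‖y - x‖ ‖v‖`, are pointwise bounded functionals, so that the
uniform boundedness principle applies. -/
theorem IsMaximallyMonotone.exists_isBounded_of_mem_interior [CompleteSpace H] {T : H → Set H}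
    (hT : IsMaximallyMonotone T) {x : H} (hx : x ∈ interior (opDom T)) :
    ∃ δ > 0, Bornology.IsBounded (⋃ y ∈ Metric.ball x δ, T y) := by
  obtain ⟨r, hr, hball⟩ := Metric.mem_nhds_iff.1 (mem_interior_iff_mem_nhds.1 hx)
  let I := {q : H × H // q.2 ∈ T q.1 ∧ ‖q.1 - x‖ ≤ 1}
  let d : I → ℝ := fun i => 1 + ‖i.1.1 - x‖ * ‖i.1.2‖
  have hd : ∀ i, 0 < d i := fun i => by positivity
  -- For `x + h` in the domain, monotonicity bounds `⟪h, v⟫` from above.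
  have hub : ∀ h : H, ‖h‖ < r → ∃ M : ℝ, 0 ≤ M ∧ ∀ i : I, inner ℝ i.1.2 h ≤ M * d i := by
    intro h hh
    obtain ⟨u, hu⟩ := hball (show x + h ∈ Metric.ball x r by simpa using hh)
    refine ⟨(‖h‖ + 1) * ‖u‖ + 1, by positivity, fun i => ?_⟩
    have h1 := hT.inner_nonneg hu i.2.1
    have h2 : inner ℝ (x + h - i.1.1) u ≤ (‖h‖ + 1) * ‖u‖ := by
      refine (real_inner_le_norm _ _).trans ?_
      gcongr
      have : x + h - i.1.1 = h - (i.1.1 - x) := by abel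
      rw [this]
      exact (norm_sub_le _ _).trans (by gcongr; exact i.2.2)
    have h3 : inner ℝ (i.1.1 - x) i.1.2 ≤ ‖i.1.1 - x‖ * ‖i.1.2‖ := real_inner_le_norm _ _
    have h4 : inner ℝ (x + h - i.1.1) i.1.2
        = inner ℝ i.1.2 h - inner ℝ (i.1.1 - x) i.1.2 := by
      rw [show x + h - i.1.1 = h - (i.1.1 - x) by abel, inner_sub_left, real_inner_comm]
    rw [inner_sub_right, h4] at h1
    have h5 : 0 ≤ (‖h‖ + 1) * ‖u‖ * (‖i.1.1 - x‖ * ‖i.1.2‖) := by positivity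
    simp only [d]
    linarith
  obtain ⟨C, hC⟩ := banach_steinhaus
    (g := fun i : I => (d i)⁻¹ • (InnerProductSpace.toDual ℝ H i.1.2)) (fun h => by
      have hs : 0 < r / (2 * (‖h‖ + 1)) := by positivity
      set s := r / (2 * (‖h‖ + 1)) with hsdef
      have hsm : ‖s • h‖ < r := by
        rw [norm_smul, Real.norm_of_nonneg hs.le, hsdef, div_mul_eq_mul_div,
          div_lt_iff₀ (by positivity)]
        nlinarith [norm_nonneg h]
      obtain ⟨M, hM, h1⟩ := hub (s • h) hsm
      obtain ⟨M', hM', h2⟩ := hub (-(s • h)) (by rwa [norm_neg])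
      refine ⟨(M + M') / s, fun i => ?_⟩
      have h1 := h1 i
      have h2 := h2 i
      rw [inner_neg_right, real_inner_smul_right] at h2
      rw [real_inner_smul_right] at h1
      have hdi := hd i
      simp only [smul_apply, InnerProductSpace.toDual_apply_apply, norm_smul,
        norm_inv, Real.norm_of_nonneg hdi.le, Real.norm_eq_abs]
      rw [inv_mul_le_iff₀ hdi, mul_div_assoc', le_div_iff₀ hs, ← abs_of_pos hs, ← abs_mul, abs_le]
      constructor <;> nlinarith [mul_nonneg hM hdi.le, mul_nonneg hM' hdi.le])
  have hC' : ∀ i : I, ‖i.1.2‖ ≤ (|C| + 1) * d i := by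
    intro i
    have h1 := (hC i).trans (le_abs_self C)
    rw [norm_smul, norm_inv, Real.norm_of_nonneg (hd i).le, LinearIsometryEquiv.norm_map,
      inv_mul_le_iff₀ (hd i)] at h1
    nlinarith [hd i]
  refine ⟨min 1 (2 * (|C| + 1))⁻¹, by positivity, ?_⟩
  rw [isBounded_iff_forall_norm_le]
  refine ⟨2 * (|C| + 1), fun v hv => ?_⟩
  simp only [Set.mem_iUnion, Metric.mem_ball, dist_eq_norm, lt_min_iff] at hv
  obtain ⟨y, ⟨hy1, hy2⟩, hv⟩ := hv
  have h1 := hC' ⟨(y, v), hv, hy1.le⟩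
  have h2 : (|C| + 1) * ‖y - x‖ ≤ 1 / 2 := by
    have h0 : 0 < |C| + 1 := by positivity
    calc (|C| + 1) * ‖y - x‖ ≤ (|C| + 1) * (2 * (|C| + 1))⁻¹ := by gcongr
      _ = 1 / 2 := by field_simp
  have h3 := mul_le_mul_of_nonneg_right h2 (norm_nonneg v)
  simp only [d] at h1
  linarith

end

/-! ### Resolvents for small step sizes -/

section

open Filter Topology

variable {H : Type*} [NormedAddCommGroup H] [InnerProductSpace ℝ H]

theorem mem_resolventOp_smul_iff {A : H → Set H} {γ : ℝ} (hγ : 0 < γ) {z w x : H} :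
    x ∈ resolventOp (fun y => γ • A y) (z - γ • w) ↔ γ⁻¹ • (z - x) - w ∈ A x := by
  rw [resolventOp, Set.mem_ofPred_eq, Set.mem_smul_set_iff_inv_smul_mem₀ hγ.ne', sub_right_comm,
    smul_sub, smul_smul, inv_mul_cancel₀ hγ.ne', one_smul]

theorem IsMaximallyMonotone.exists_mem_resolventOp [CompleteSpace H] {A : H → Set H}
    (hA : IsMaximallyMonotone A) {γ : ℝ} (hγ : 0 < γ) (u : H) :
    ∃ x, x ∈ resolventOp (fun y => γ • A y) u := by
  obtain ⟨x, hx⟩ := hA.exists_inv_smul_mem hγ u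
  exact ⟨x, (Set.mem_smul_set_iff_inv_smul_mem₀ hγ.ne' _ _).2 hx⟩

theorem mem_opDom_of_mem_resolventOp {A : H → Set H} {γ : ℝ} {u x : H}
    (hx : x ∈ resolventOp (fun y => γ • A y) u) : x ∈ opDom A := by
  obtain ⟨a, ha, -⟩ := hx
  exact ⟨a, ha⟩

theorem norm_inv_smul_sub {γ : ℝ} (hγ : 0 < γ) (z x : H) : ‖γ⁻¹ • (z - x)‖ = ‖z - x‖ / γ := by
  rw [norm_smul, norm_inv, Real.norm_of_nonneg hγ.le, inv_mul_eq_div]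

/-- The quotient `‖z - J_{γA} (z - γ w)‖ / γ` is a nonincreasing function of `γ`. -/
theorem IsMaximallyMonotone.norm_sub_div_le {A : H → Set H} (hA : IsMaximallyMonotone A)
    {γ γ' : ℝ} (hγ' : 0 < γ') (hle : γ' ≤ γ) {z w x x' : H} (hx : γ⁻¹ • (z - x) - w ∈ A x)
    (hx' : γ'⁻¹ • (z - x') - w ∈ A x') : ‖z - x‖ / γ ≤ ‖z - x'‖ / γ' := by
  have hγ := hγ'.trans_le hle
  rw [← norm_inv_smul_sub hγ, ← norm_inv_smul_sub hγ']
  set q := γ⁻¹ • (z - x) with hq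
  set q' := γ'⁻¹ • (z - x') with hq'
  have e : x - x' = γ' • q' - γ • q := by
    rw [hq, hq', smul_smul, smul_smul, mul_inv_cancel₀ hγ.ne', mul_inv_cancel₀ hγ'.ne']; module
  clear_value q q'
  have h1 := hA.inner_nonneg hx hx'
  rw [e, sub_sub_sub_cancel_right, inner_sub_left, inner_sub_right, inner_sub_right,
    real_inner_smul_left, real_inner_smul_left, real_inner_smul_left, real_inner_smul_left,
    real_inner_self_eq_norm_sq, real_inner_self_eq_norm_sq, real_inner_comm q q'] at h1
  have h2 := real_inner_le_norm q q'
  by_contra! hlt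
  have h3 : γ' * ‖q'‖ < γ * ‖q‖ := by
    calc γ' * ‖q'‖ < γ' * ‖q‖ := by gcongr
      _ ≤ γ * ‖q‖ := by gcongr
  nlinarith [mul_le_mul_of_nonneg_left h2 (add_pos hγ hγ').le,
    mul_pos (sub_pos.2 hlt) (sub_pos.2 h3)]

theorem IsMaximallyMonotone.resolvent_unique {A : H → Set H} (hA : IsMaximallyMonotone A) {γ : ℝ}
    (hγ : 0 < γ) {z w x x' : H} (hx : γ⁻¹ • (z - x) - w ∈ A x)
    (hx' : γ⁻¹ • (z - x') - w ∈ A x') : x = x' := by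
  have h := hA.inner_nonneg hx hx'
  have e : γ⁻¹ • (z - x) - w - (γ⁻¹ • (z - x') - w) = -(γ⁻¹ • (x - x')) := by module
  rw [e, inner_neg_right, real_inner_smul_right, real_inner_self_eq_norm_sq] at h
  by_contra hne
  have := mul_pos (inv_pos.2 hγ) (pow_pos (norm_pos_iff.2 (sub_ne_zero.2 hne)) 2)
  linarith

/-- If `γ k → 0`, then `J_{γ k A} (z - γ k w)` converges strongly to a point of the closure of the
domain of `A`. The limit is the projection of `z` onto the closed convex hull of the domain. -/
theorem IsMaximallyMonotone.exists_tendsto_resolvent [CompleteSpace H] {A : H → Set H}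
    (hA : IsMaximallyMonotone A) {γ : ℕ → ℝ} (hγ : ∀ k, 0 < γ k) (hγ0 : Tendsto γ atTop (𝓝 0))
    {z w : H} {x : ℕ → H} (hx : ∀ k, (γ k)⁻¹ • (z - x k) - w ∈ A (x k)) :
    ∃ p ∈ closure (opDom A), Tendsto x atTop (𝓝 p) := by
  have hmono : ∀ k y, ∀ v ∈ A y,
      γ k * inner ℝ (x k - y) (w + v) ≤ inner ℝ (x k - y) (z - x k) := by
    intro k y v hv
    have h := hA.inner_nonneg (hx k) hv
    rw [sub_sub, inner_sub_right, real_inner_smul_right] at h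
    have := mul_le_mul_of_nonneg_left (sub_nonneg.1 h) (hγ k).le
    rwa [mul_inv_cancel_left₀ (hγ k).ne'] at this
  obtain ⟨y₀, v₀, hv₀⟩ := hA.exists_mem
  obtain ⟨Γ, hΓ⟩ := hγ0.bddAbove_range
  have hbd : ∃ R > 0, ∀ k, ‖x k‖ ≤ R := by
    refine ⟨‖y₀‖ + (‖z - y₀‖ + |Γ| * ‖w + v₀‖) + 1, by positivity, fun k => ?_⟩
    have h1 := hmono k y₀ v₀ hv₀
    have h2 : inner ℝ (x k - y₀) (z - x k)
        = inner ℝ (x k - y₀) (z - y₀) - ‖x k - y₀‖ ^ 2 := by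
      rw [← real_inner_self_eq_norm_sq, ← inner_sub_right, sub_sub_sub_cancel_right]
    have h3 := real_inner_le_norm (x k - y₀) (z - y₀)
    have h4 := (abs_le.1 (abs_real_inner_le_norm (x k - y₀) (w + v₀))).1
    have h5 : γ k ≤ |Γ| := (hΓ ⟨k, rfl⟩).trans (le_abs_self Γ)
    have h6 : γ k * (‖x k - y₀‖ * ‖w + v₀‖) ≤ |Γ| * (‖x k - y₀‖ * ‖w + v₀‖) := by gcongr
    have h7 := mul_le_mul_of_nonneg_left h4 (hγ k).le
    have h8 : ‖x k - y₀‖ ≤ ‖z - y₀‖ + |Γ| * ‖w + v₀‖ := by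
      rcases (norm_nonneg (x k - y₀)).eq_or_lt with h0 | h0
      · rw [← h0]; positivity
      · refine le_of_mul_le_mul_left ?_ h0
        nlinarith
    have h9 : ‖x k‖ ≤ ‖y₀‖ + ‖x k - y₀‖ := by
      simpa using norm_add_le y₀ (x k - y₀)
    linarith
  obtain ⟨R, hR, hxR⟩ := hbd
  have hzx : ∀ k, ‖z - x k‖ ≤ ‖z‖ + R := fun k =>
    (norm_sub_le _ _).trans (by gcongr; exact hxR k)
  -- The asymptotic variational inequality passes from the domain to its closed convex hull.
  let D : Set H := {y | ∀ δ > 0, ∀ᶠ k in atTop, -δ ≤ inner ℝ (x k - y) (z - x k)}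
  have hdom : opDom A ⊆ D := by
    rintro y ⟨v, hv⟩ δ hδ
    have h0 : Tendsto (fun k => γ k * ((R + ‖y‖) * ‖w + v‖)) atTop (𝓝 0) := by
      simpa using hγ0.mul_const ((R + ‖y‖) * ‖w + v‖)
    filter_upwards [h0.eventually_lt_const hδ] with k hk
    have h1 := hmono k y v hv
    have h2 := (abs_le.1 (abs_real_inner_le_norm (x k - y) (w + v))).1
    have h3 : ‖x k - y‖ * ‖w + v‖ ≤ (R + ‖y‖) * ‖w + v‖ := by
      gcongr
      exact (norm_sub_le _ _).trans (by gcongr; exact hxR k)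
    have h4 := mul_le_mul_of_nonneg_left h2 (hγ k).le
    have h5 := mul_le_mul_of_nonneg_left h3 (hγ k).le
    linarith
  have hDc : Convex ℝ D := by
    intro y hy y' hy' a b ha hb hab δ hδ
    filter_upwards [hy δ hδ, hy' δ hδ] with k h1 h2
    have e : x k - (a • y + b • y') = a • (x k - y) + b • (x k - y') := by
      rw [smul_sub, smul_sub, sub_add_sub_comm, ← add_smul, hab, one_smul]
    rw [e, inner_add_left, real_inner_smul_left, real_inner_smul_left]
    calc -δ = a * -δ + b * -δ := by rw [← add_mul, hab, one_mul]
      _ ≤ _ := by gcongr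
  have hDcl : IsClosed D := by
    refine isClosed_of_closure_subset fun y hy δ hδ => ?_
    have hpos : 0 < ‖z‖ + R := by positivity
    obtain ⟨y', hy', hyy'⟩ := Metric.mem_closure_iff.1 hy (δ / (2 * (‖z‖ + R))) (by positivity)
    filter_upwards [hy' (δ / 2) (by positivity)] with k hk
    have h1 : |inner ℝ (y - y') (z - x k)| ≤ δ / 2 := by
      refine (abs_real_inner_le_norm _ _).trans ?_
      rw [dist_eq_norm] at hyy'
      calc ‖y - y'‖ * ‖z - x k‖ ≤ δ / (2 * (‖z‖ + R)) * (‖z‖ + R) := by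
            gcongr
            exact hzx k
        _ = δ / 2 := by field_simp
    have e : x k - y = (x k - y') - (y - y') := by abel
    rw [e, inner_sub_left]
    linarith [(abs_le.1 h1).2]
  have hxdom : ∀ k, x k ∈ opDom A := fun k => ⟨_, hx k⟩
  obtain ⟨p, hpC, hp⟩ := exists_norm_sub_forall_inner_nonpos
    (C := closedConvexHull ℝ (opDom A)) ⟨_, subset_closedConvexHull (hxdom 0)⟩
    isClosed_closedConvexHull convex_closedConvexHull z
  have hpD : p ∈ D := closedConvexHull_min hdom hDc hDcl hpC
  have hlim : Tendsto x atTop (𝓝 p) := by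
    rw [Metric.tendsto_atTop']
    intro δ hδ
    obtain ⟨N, hN⟩ := eventually_atTop.1 (hpD (δ ^ 2 / 2) (by positivity))
    refine ⟨N, fun k hk => ?_⟩
    have h1 := hN k hk.le
    have h2 := hp (x k) (subset_closedConvexHull (hxdom k))
    rw [real_inner_comm] at h2
    have h3 : inner ℝ (x k - p) (z - x k) = inner ℝ (x k - p) (z - p) - ‖x k - p‖ ^ 2 := by
      rw [← real_inner_self_eq_norm_sq, ← inner_sub_right, sub_sub_sub_cancel_right]
    rw [dist_eq_norm]
    refine lt_of_pow_lt_pow_left₀ 2 hδ.le ?_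
    have := pow_pos hδ 2
    linarith
  exact ⟨p, mem_closure_of_tendsto hlim (Eventually.of_forall hxdom), hlim⟩

/-! ### The line search -/

/-- The line search terminates. If it failed for all steps `γ k = ρ σ ^ (k + 1)`, then the quotients
`q k = (z - x k) / γ k`, whose norms are nondecreasing, would satisfy `θ ‖q k‖ < ‖b - B₃ (x k)‖`. For
`z` in the domain of `A` the right-hand side tends to `0`, which forces `q k = 0` and `x k = z`.
Otherwise the right-hand side is bounded because `x k` converges to a point of the closure of the
domain; then `x k → z`, and `z` lies in the domain after all, since `q k - w ∈ A (x k)` is bounded. -/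
theorem exists_lineSearchTest [CompleteSpace H] {A : H → Set H} (hA : IsMaximallyMonotone A)
    {B₁ B₂ : H → H} {B₃ : H → Set H} {f : H → H} (hf : ∀ x ∈ opDom A, B₃ x = {f x})
    (hfc : ContinuousOn f (opDom A)) {ρ σ θ : ℝ} (hρ : 0 < ρ) (hσ : σ ∈ Set.Ioo (0 : ℝ) 1)
    (hθ : 0 < θ) {z b : H} (hb : b ∈ B₃ z)
    (hz : z ∈ opDom A ∨ IsLocallyBoundedIn B₃ (closure (opDom A))) :
    ∃ k : ℕ, 1 ≤ k ∧ LineSearchTest A B₁ B₂ B₃ θ z b (ρ * σ ^ k) := by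
  by_contra! hfail
  set w := B₁ z + B₂ z + b with hw
  set γ : ℕ → ℝ := fun k => ρ * σ ^ (k + 1) with hγdef
  have hγ : ∀ k, 0 < γ k := fun k => mul_pos hρ (pow_pos hσ.1 _)
  have hγ0 : Tendsto γ atTop (𝓝 0) := by
    have := ((tendsto_pow_atTop_nhds_zero_of_lt_one hσ.1.le hσ.2).comp
      (tendsto_add_atTop_nat 1)).const_mul ρ
    simpa [hγdef, Function.comp_def] using this
  have hanti : Antitone γ := fun i j hij => by
    simp only [hγdef]
    exact mul_le_mul_of_nonneg_left
      (pow_le_pow_of_le_one hσ.1.le hσ.2.le (by omega)) hρ.le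
  choose x hx using fun k => hA.exists_mem_resolventOp (hγ k) (z - γ k • w)
  have hxA : ∀ k, (γ k)⁻¹ • (z - x k) - w ∈ A (x k) := fun k =>
    (mem_resolventOp_smul_iff (hγ k)).1 (hx k)
  have hxdom : ∀ k, x k ∈ opDom A := fun k => ⟨_, hxA k⟩
  have hlt : ∀ k, θ * (‖z - x k‖ / γ k) < ‖b - f (x k)‖ := by
    intro k
    have h := hfail (k + 1) (by omega)
    rw [LineSearchTest] at h
    push Not at h
    have := h (x k) (hx k) (f (x k)) (by rw [hf _ (hxdom k)]; rfl)
    rwa [mul_div_assoc', div_lt_iff₀ (hγ k), mul_comm ‖b - f (x k)‖]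
  have hxz : ∀ {M : ℝ}, (∀ᶠ k in atTop, ‖z - x k‖ / γ k ≤ M) → Tendsto x atTop (𝓝 z) := by
    intro M hM
    rw [tendsto_iff_norm_sub_tendsto_zero]
    refine squeeze_zero' (Eventually.of_forall fun _ => norm_nonneg _) ?_
      (by simpa using hγ0.mul_const M)
    filter_upwards [hM] with k hk
    rw [norm_sub_rev, mul_comm]
    exact (div_le_iff₀ (hγ k)).1 hk
  by_cases hzA : z ∈ opDom A
  · have hbz : b = f z := by rw [hf z hzA] at hb; exact hb
    obtain ⟨a, ha⟩ := hzA
    have hxz' : Tendsto x atTop (𝓝 z) := by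
      refine hxz (M := ‖w + a‖) (Eventually.of_forall fun k => ?_)
      have h1 := hA.inner_nonneg (hxA k) ha
      rw [← norm_inv_smul_sub (hγ k)]
      set q := (γ k)⁻¹ • (z - x k) with hq
      have e : x k - z = -(γ k • q) := by
        rw [hq, smul_smul, mul_inv_cancel₀ (hγ k).ne']; module
      rw [e, sub_sub, inner_neg_left, real_inner_smul_left, inner_sub_right,
        real_inner_self_eq_norm_sq] at h1
      have h2 := real_inner_le_norm q (w + a)
      have h3 : ‖q‖ ^ 2 - inner ℝ q (w + a) ≤ 0 := by
        by_contra! hlt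
        have := mul_pos (hγ k) hlt
        linarith
      rcases (norm_nonneg q).eq_or_lt with h0 | h0
      · rw [← h0]; exact norm_nonneg _
      · refine le_of_mul_le_mul_left ?_ h0
        linarith
    have hfx : Tendsto (fun k => ‖b - f (x k)‖) atTop (𝓝 0) := by
      have h1 : Tendsto (fun k => f (x k)) atTop (𝓝 (f z)) :=
        (hfc z ⟨a, ha⟩).tendsto.comp
          (tendsto_nhdsWithin_iff.2 ⟨hxz', Eventually.of_forall hxdom⟩)
      simpa [hbz] using (tendsto_const_nhds (x := b)).sub h1 |>.norm
    have h0 : θ * (‖z - x 0‖ / γ 0) ≤ 0 := by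
      refine ge_of_tendsto hfx (Eventually.of_forall fun k => ?_)
      refine le_trans ?_ (hlt k).le
      exact mul_le_mul_of_nonneg_left
        (hA.norm_sub_div_le (hγ k) (hanti (Nat.zero_le k)) (hxA 0) (hxA k)) hθ.le
    have h1 : ‖z - x 0‖ = 0 := by
      refine le_antisymm ?_ (norm_nonneg _)
      by_contra! hpos
      have := mul_pos hθ (div_pos hpos (hγ 0))
      linarith
    have h2 := hlt 0
    rw [h1, ← sub_eq_zero.1 (norm_eq_zero.1 h1), hbz] at h2
    simp at h2
  · obtain ⟨p, hp, hxp⟩ := hA.exists_tendsto_resolvent hγ hγ0 hxA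
    obtain ⟨δ, hδ, hbdd⟩ := (hz.resolve_left hzA) p hp
    obtain ⟨M, hM⟩ := isBounded_iff_forall_norm_le.1 hbdd
    have hq : ∀ᶠ k in atTop, ‖z - x k‖ / γ k ≤ (‖b‖ + M) / θ := by
      filter_upwards [hxp (Metric.ball_mem_nhds p hδ)] with k hk
      have h1 : ‖f (x k)‖ ≤ M := hM _ (Set.mem_iUnion₂.2 ⟨x k, hk, by rw [hf _ (hxdom k)]; rfl⟩)
      rw [le_div_iff₀ hθ, mul_comm]
      exact (hlt k).le.trans ((norm_sub_le _ _).trans (by gcongr))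
    let U : Ultrafilter ℕ := Ultrafilter.of atTop
    have hU : (U : Filter ℕ) ≤ atTop := Ultrafilter.of_le _
    have hR : ∀ᶠ k in (U : Filter ℕ), ‖(γ k)⁻¹ • (z - x k) - w‖ ≤ (‖b‖ + M) / θ + ‖w‖ := by
      filter_upwards [hU hq] with k hk
      refine (norm_sub_le _ _).trans ?_
      rw [norm_inv_smul_sub (hγ k)]
      gcongr
    obtain ⟨a, ha⟩ := U.exists_tendsto_inner hR
    exact hzA ⟨a, hA.mem_of_strong_of_weak (Eventually.of_forall hxA) hR
      ((hxz hq).mono_left hU) ha⟩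

/-- The admissible step sizes that pass a test have a greatest element as soon as there are any. -/
theorem exists_isGreatest_geometric {ρ σ : ℝ} (hρ : 0 < ρ) (hσ : σ ∈ Set.Ioo (0 : ℝ) 1)
    {P : ℝ → Prop} (h : ∃ k : ℕ, 1 ≤ k ∧ P (ρ * σ ^ k)) :
    ∃ γ, IsGreatest {γ : ℝ | (∃ k : ℕ, 1 ≤ k ∧ γ = ρ * σ ^ k) ∧ P γ} γ := by
  classical
  refine ⟨ρ * σ ^ Nat.find h, ⟨⟨_, (Nat.find_spec h).1, rfl⟩, (Nat.find_spec h).2⟩, ?_⟩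
  rintro _ ⟨⟨k, hk, rfl⟩, hP⟩
  have hle : Nat.find h ≤ k := Nat.find_min' h ⟨hk, hP⟩
  exact mul_le_mul_of_nonneg_left (pow_le_pow_of_le_one hσ.1.le hσ.2.le hle) hρ.le

/-! ### Existence and uniqueness of the sequences -/

theorem IsProjectionOnto.inner_nonpos {X : Set H} (hX : Convex ℝ X) {u p : H}
    (hp : IsProjectionOnto X u p) : ∀ q ∈ X, inner ℝ (u - p) (q - p) ≤ 0 := by
  refine (norm_eq_iInf_iff_real_inner_le_zero hX hp.1).1 (le_antisymm ?_ ?_)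
  · have : Nonempty X := ⟨⟨p, hp.1⟩⟩
    exact le_ciInf fun q => hp.2 q q.2
  · exact ciInf_le (f := fun q : X => ‖u - q‖)
      ⟨0, by rintro _ ⟨q, rfl⟩; exact norm_nonneg _⟩ ⟨p, hp.1⟩

theorem IsProjectionOnto.norm_sub_le {X : Set H} (hX : Convex ℝ X) {u p : H}
    (hp : IsProjectionOnto X u p) {q : H} (hq : q ∈ X) : ‖p - q‖ ≤ ‖u - q‖ := by
  have h := hp.inner_nonpos hX q hq
  refine le_of_sq_le_sq ?_ (norm_nonneg _)
  have e : u - q = (u - p) - (q - p) := by abel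
  rw [e, norm_sub_rev p q, norm_sub_sq_real (u - p)]
  nlinarith [sq_nonneg ‖u - p‖]

theorem IsProjectionOnto.unique {X : Set H} (hX : Convex ℝ X) {u p q : H}
    (hp : IsProjectionOnto X u p) (hq : IsProjectionOnto X u q) : p = q := by
  have h1 := hp.inner_nonpos hX q hq.1
  have h2 := hq.inner_nonpos hX p hp.1
  have e : inner ℝ (p - q) (p - q) = inner ℝ (u - p) (q - p) + inner ℝ (u - q) (p - q) := by
    rw [← neg_sub p q, inner_neg_right, neg_add_eq_sub, ← inner_sub_left, sub_sub_sub_cancel_left]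
  have h3 : inner ℝ (p - q) (p - q) ≤ (0 : ℝ) := by linarith
  exact sub_eq_zero.1 (real_inner_self_nonpos.1 h3)

theorem exists_isProjectionOnto [CompleteSpace H] {X : Set H} (hne : X.Nonempty)
    (hcl : IsClosed X) (hX : Convex ℝ X) (u : H) : ∃ p, IsProjectionOnto X u p := by
  obtain ⟨p, hp, h⟩ := exists_norm_eq_iInf_of_complete_convex hne hcl.isComplete hX u
  refine ⟨p, hp, fun q hq => ?_⟩
  rw [h]
  exact ciInf_le (f := fun q : X => ‖u - q‖)
    ⟨0, by rintro _ ⟨q, rfl⟩; exact norm_nonneg _⟩ ⟨q, hq⟩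

variable {X : Set H} {A : H → Set H} {B₁ B₂ : H → H} {B₃ : H → Set H} {ρ σ θ : ℝ}

theorem IsFBHF.exists_pow {s : FBHFSequences H} (hs : IsFBHF X A B₁ B₂ B₃ ρ σ θ s) (n : ℕ) :
    ∃ k : ℕ, 1 ≤ k ∧ s.γ n = ρ * σ ^ k := (hs.step_size n).1.1

theorem IsFBHF.step_pos (hρ : 0 < ρ) (hσ : σ ∈ Set.Ioo (0 : ℝ) 1) {s : FBHFSequences H}
    (hs : IsFBHF X A B₁ B₂ B₃ ρ σ θ s) (n : ℕ) : 0 < s.γ n := by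
  obtain ⟨k, -, h⟩ := hs.exists_pow n
  rw [h]
  exact mul_pos hρ (pow_pos hσ.1 _)

theorem IsFBHF.x_mem_opDom {s : FBHFSequences H} (hs : IsFBHF X A B₁ B₂ B₃ ρ σ θ s) (n : ℕ) :
    s.x n ∈ opDom A := mem_opDom_of_mem_resolventOp (hs.x_mem n)

theorem IsFBHF.unique (hX : Convex ℝ X) (hA : IsMaximallyMonotone A) {f : H → H}
    (hf : ∀ x ∈ opDom A ∪ X, B₃ x = {f x}) (hρ : 0 < ρ) (hσ : σ ∈ Set.Ioo (0 : ℝ) 1)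
    {s t : FBHFSequences H} (hs : IsFBHF X A B₁ B₂ B₃ ρ σ θ s)
    (ht : IsFBHF X A B₁ B₂ B₃ ρ σ θ t) (hz : s.z 0 = t.z 0) (hb : s.b 0 = t.b 0) : s = t := by
  have hval : ∀ {x c c' : H}, x ∈ opDom A ∪ X → c ∈ B₃ x → c' ∈ B₃ x → c = c' := by
    intro x c c' hx hc hc'
    rw [hf x hx, Set.mem_singleton_iff] at hc hc'
    rw [hc, hc']
  have hstep : ∀ n, s.z n = t.z n → s.b n = t.b n →
      s.γ n = t.γ n ∧ s.x n = t.x n ∧ s.c n = t.c n := by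
    intro n hz hb
    have hγ : s.γ n = t.γ n := by
      have h := ht.step_size n
      rw [← hz, ← hb] at h
      exact (hs.step_size n).unique h
    have hx : s.x n = t.x n := by
      have h1 := hs.x_mem n
      have h2 := ht.x_mem n
      rw [← hz, ← hb, ← hγ] at h2
      have hpos := hs.step_pos hρ hσ n
      exact hA.resolvent_unique hpos ((mem_resolventOp_smul_iff hpos).1 h1)
        ((mem_resolventOp_smul_iff hpos).1 h2)
    refine ⟨hγ, hx, hval (Or.inl (hs.x_mem_opDom n)) (hs.c_mem n) ?_⟩
    rw [hx]
    exact ht.c_mem n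
  have hzb : ∀ n, s.z n = t.z n ∧ s.b n = t.b n := by
    intro n
    induction n with
    | zero => exact ⟨hz, hb⟩
    | succ n ih =>
      obtain ⟨hγ, hx, hc⟩ := hstep n ih.1 ih.2
      have h1 := hs.z_succ n
      have h2 := ht.z_succ n
      rw [← ih.1, ← ih.2, ← hγ, ← hx, ← hc] at h2
      have h3 := h1.unique hX h2
      refine ⟨h3, hval (Or.inr h1.1) (hs.b_mem _) ?_⟩
      rw [h3]
      exact ht.b_mem _
  have hall := fun n => hstep n (hzb n).1 (hzb n).2
  cases s
  cases t
  simp only [FBHFSequences.mk.injEq]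
  exact ⟨funext fun n => (hzb n).1, funext fun n => (hall n).2.1, funext fun n => (hzb n).2,
    funext fun n => (hall n).2.2, funext fun n => (hall n).1⟩

/-- The sequences exist as soon as the line search terminates at the starting point and at every
point of `X`. -/
theorem exists_isFBHF [CompleteSpace H] (hne : X.Nonempty) (hcl : IsClosed X) (hX : Convex ℝ X)
    (hA : IsMaximallyMonotone A) (hdom : opDom A ∪ X ⊆ opDom B₃) (hρ : 0 < ρ)
    (hσ : σ ∈ Set.Ioo (0 : ℝ) 1) {z₀ b₀ : H} (hb₀ : b₀ ∈ B₃ z₀)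
    (h₀ : ∃ k : ℕ, 1 ≤ k ∧ LineSearchTest A B₁ B₂ B₃ θ z₀ b₀ (ρ * σ ^ k))
    (hls : ∀ z ∈ X, ∀ b ∈ B₃ z,
      ∃ k : ℕ, 1 ≤ k ∧ LineSearchTest A B₁ B₂ B₃ θ z b (ρ * σ ^ k)) :
    ∃ s : FBHFSequences H, IsFBHF X A B₁ B₂ B₃ ρ σ θ s ∧ s.z 0 = z₀ ∧ s.b 0 = b₀ := by
  -- The states of the recursion are the pairs `(z, b)`.
  let S := {q : H × H // q.2 ∈ B₃ q.1 ∧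
    ∃ k : ℕ, 1 ≤ k ∧ LineSearchTest A B₁ B₂ B₃ θ q.1 q.2 (ρ * σ ^ k)}
  have hγ : ∀ q : S, ∃ γ, IsGreatest {γ : ℝ | (∃ k : ℕ, 1 ≤ k ∧ γ = ρ * σ ^ k) ∧
      LineSearchTest A B₁ B₂ B₃ θ q.1.1 q.1.2 γ} γ := fun q =>
    exists_isGreatest_geometric hρ hσ q.2.2
  choose γ hγ using hγ
  have hγpos : ∀ q, 0 < γ q := fun q => by
    obtain ⟨⟨⟨k, -, h⟩, -⟩, -⟩ := hγ q
    rw [h]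
    exact mul_pos hρ (pow_pos hσ.1 _)
  choose x hx using fun q : S => hA.exists_mem_resolventOp (hγpos q)
    (q.1.1 - γ q • (B₁ q.1.1 + B₂ q.1.1 + q.1.2))
  choose c hc using fun q : S => hdom (Or.inl (mem_opDom_of_mem_resolventOp (hx q)))
  choose z' hz' using fun q : S => exists_isProjectionOnto hne hcl hX
    (x q + γ q • (B₂ q.1.1 + q.1.2) - γ q • (B₂ (x q) + c q))
  choose b' hb' using fun q : S => hdom (Or.inr (hz' q).1)
  let next : S → S := fun q => ⟨(z' q, b' q), hb' q, hls _ (hz' q).1 _ (hb' q)⟩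
  let q : ℕ → S := fun n => next^[n] ⟨(z₀, b₀), hb₀, h₀⟩
  have hq : ∀ n, q (n + 1) = next (q n) := fun n => Function.iterate_succ_apply' _ _ _
  refine ⟨⟨fun n => (q n).1.1, fun n => x (q n), fun n => (q n).1.2, fun n => c (q n),
    fun n => γ (q n)⟩, ⟨fun n => (q n).2.1, fun n => hγ _, fun n => hx _, fun n => hc _,
    fun n => ?_⟩, rfl, rfl⟩
  simp only [hq]
  exact hz' _

end

/-! ### Fejér monotonicity -/

section

open Filter Topology

theorem isInclusionSolution_iff {H : Type*} [AddCommGroup H] {X : Set H} {A : H → Set H}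
    {B₁ B₂ : H → H} {B₃ : H → Set H} {x : H} : IsInclusionSolution X A B₁ B₂ B₃ x ↔
    x ∈ X ∧ ∃ a ∈ A x, ∃ b ∈ B₃ x, a + B₁ x + B₂ x + b = 0 := by
  simp only [IsInclusionSolution, Set.mem_add, Set.mem_singleton_iff]
  constructor
  · rintro ⟨hx, _, ⟨_, ⟨a, ha, _, rfl, rfl⟩, _, rfl, rfl⟩, b, hb, h⟩
    exact ⟨hx, a, ha, b, hb, h⟩
  · rintro ⟨hx, a, ha, b, hb, h⟩
    exact ⟨hx, _, ⟨_, ⟨a, ha, _, rfl, rfl⟩, _, rfl, rfl⟩, b, hb, h⟩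

variable {H : Type*} [NormedAddCommGroup H] [InnerProductSpace ℝ H]
  {X : Set H} {A : H → Set H} {B₁ B₂ : H → H} {B₃ : H → Set H}

theorem IsCocoercive.norm_sub_le {β : ℝ} (hβ : 0 < β) (hB₁ : IsCocoercive β B₁) (x y : H) :
    ‖B₁ x - B₁ y‖ ≤ β⁻¹ * ‖x - y‖ := by
  have h1 := hB₁ x y
  have h2 := real_inner_le_norm (x - y) (B₁ x - B₁ y)
  rw [← div_eq_inv_mul, le_div_iff₀ hβ]
  rcases (norm_nonneg (B₁ x - B₁ y)).eq_or_lt with h0 | h0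
  · rw [← h0, zero_mul]; exact norm_nonneg _
  · refine le_of_mul_le_mul_left ?_ h0
    linarith

/-- The basic estimate of one forward-backward-half-forward step, for a point `p` that is
monotonically related to the data as a solution is. -/
theorem IsCocoercive.norm_forward_sub_sq_le {β ε γ κ : ℝ} (hB₁ : IsCocoercive β B₁)
    (hε : 0 < ε) (hγ : 0 < γ) (hγβ : γ ≤ 2 * β * ε) {z x u v p : H}
    (hmono : 0 ≤ inner ℝ (x - p) (γ⁻¹ • (z - x) - B₁ z - u + v + B₁ p))
    (hκ : γ * ‖u - v‖ ≤ κ * ‖z - x‖) :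
    ‖x + γ • (u - v) - p‖ ^ 2 ≤ ‖z - p‖ ^ 2 - (1 - ε - κ ^ 2) * ‖z - x‖ ^ 2 := by
  have e1 : x + γ • (u - v) - p = (x - p) + γ • (u - v) := by abel
  have e2 : z - p = (z - x) + (x - p) := by abel
  have e3 : γ⁻¹ • (z - x) - B₁ z - u + v + B₁ p
      = γ⁻¹ • (z - x) - (B₁ z - B₁ p) - (u - v) := by abel
  have h1 : inner ℝ (x - p) (B₁ z - B₁ p)
      = inner ℝ (z - p) (B₁ z - B₁ p) - inner ℝ (z - x) (B₁ z - B₁ p) := by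
    rw [← inner_sub_left, sub_sub_sub_cancel_left]
  have h2 := hB₁ z p
  have h3 := real_inner_le_norm (z - x) (B₁ z - B₁ p)
  rw [e3, inner_sub_right, inner_sub_right, real_inner_smul_right] at hmono
  have h4 := mul_le_mul_of_nonneg_left hmono hγ.le
  rw [mul_zero, mul_sub, mul_sub, mul_inv_cancel_left₀ hγ.ne', h1] at h4
  have h5 : (γ * ‖u - v‖) ^ 2 ≤ (κ * ‖z - x‖) ^ 2 := by gcongr
  rw [e1, norm_add_sq_real, e2, norm_add_sq_real, real_inner_smul_right, norm_smul,
    Real.norm_of_nonneg hγ.le, real_inner_comm (x - p) (z - x)]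
  set d := ‖B₁ z - B₁ p‖
  set r := ‖z - x‖
  have h6 : γ * (β * d ^ 2) ≤ γ * inner ℝ (z - p) (B₁ z - B₁ p) := by gcongr
  have h7 : γ * inner ℝ (z - x) (B₁ z - B₁ p) ≤ γ * (r * d) := by gcongr
  -- Young's inequality, with the weights that the bound `γ ≤ 2 β ε` permits.
  have h8 : 2 * (γ * (r * d)) ≤ ε * r ^ 2 + 2 * (γ * (β * d ^ 2)) := by
    have h9 : γ * γ * d ^ 2 ≤ γ * (2 * β * ε) * d ^ 2 := by gcongr
    have h10 : 0 ≤ ε * (ε * r ^ 2 + 2 * (γ * (β * d ^ 2)) - 2 * (γ * (r * d))) := by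
      nlinarith [sq_nonneg (ε * r - γ * d)]
    have := nonneg_of_mul_nonneg_right h10 hε
    linarith
  linarith

theorem IsFBHF.c_eq {f : H → H} {ρ σ θ : ℝ} (hf : ∀ x ∈ opDom A ∪ X, B₃ x = {f x})
    {s : FBHFSequences H} (hs : IsFBHF X A B₁ B₂ B₃ ρ σ θ s) (n : ℕ) {c : H}
    (hc : c ∈ B₃ (s.x n)) : c = s.c n := by
  have h := hs.c_mem n
  rw [hf _ (Or.inl (hs.x_mem_opDom n)), Set.mem_singleton_iff] at h hc
  rw [h, hc]

theorem IsFBHF.mul_norm_sub_le {f : H → H} {ρ σ θ : ℝ} (hA : IsMaximallyMonotone A)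
    (hf : ∀ x ∈ opDom A ∪ X, B₃ x = {f x}) (hρ : 0 < ρ) (hσ : σ ∈ Set.Ioo (0 : ℝ) 1)
    {s : FBHFSequences H} (hs : IsFBHF X A B₁ B₂ B₃ ρ σ θ s) (n : ℕ) :
    s.γ n * ‖s.b n - s.c n‖ ≤ θ * ‖s.z n - s.x n‖ := by
  obtain ⟨x, hx, c, hc, h⟩ := (hs.step_size n).1.2
  have hpos := hs.step_pos hρ hσ n
  obtain rfl : x = s.x n := hA.resolvent_unique hpos
    ((mem_resolventOp_smul_iff hpos).1 hx) ((mem_resolventOp_smul_iff hpos).1 (hs.x_mem n))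
  rwa [hs.c_eq hf n hc] at h

theorem IsFBHF.step_le {ρ σ θ : ℝ} (hρ : 0 < ρ) (hσ : σ ∈ Set.Ioo (0 : ℝ) 1)
    {s : FBHFSequences H} (hs : IsFBHF X A B₁ B₂ B₃ ρ σ θ s) (n : ℕ) : s.γ n ≤ ρ * σ := by
  obtain ⟨k, hk, h⟩ := hs.exists_pow n
  rw [h]
  exact mul_le_mul_of_nonneg_left (pow_le_of_le_one hσ.1.le hσ.2.le (by omega)) hρ.le

/-- The iterates are Fejér monotone with respect to the solutions, with a quantified decrease. -/
theorem IsFBHF.norm_sub_sq_le {β L ε ρ σ θ : ℝ} {f : H → H} (hX : Convex ℝ X)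
    (hA : IsMaximallyMonotone A) (hB₁ : IsCocoercive β B₁) (hB₂ : IsMonotoneMap B₂)
    (hB₂L : ∀ x y, ‖B₂ x - B₂ y‖ ≤ L * ‖x - y‖) (hB₃ : IsMaximallyMonotone B₃)
    (hf : ∀ x ∈ opDom A ∪ X, B₃ x = {f x}) (hε : 0 < ε) (hρ : 0 < ρ) (hρβ : ρ ≤ 2 * β * ε)
    (hσ : σ ∈ Set.Ioo (0 : ℝ) 1) {s : FBHFSequences H} (hs : IsFBHF X A B₁ B₂ B₃ ρ σ θ s)
    {p : H} (hp : IsInclusionSolution X A B₁ B₂ B₃ p) (n : ℕ) :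
    ‖s.z (n + 1) - p‖ ^ 2 ≤ ‖s.z n - p‖ ^ 2
      - (1 - ε - (L * ρ * σ + θ) ^ 2) * ‖s.z n - s.x n‖ ^ 2 := by
  obtain ⟨hpX, a, ha, b, hb, hab⟩ := isInclusionSolution_iff.1 hp
  have hpos := hs.step_pos hρ hσ n
  have hle := hs.step_le hρ hσ n
  have hxA := (mem_resolventOp_smul_iff hpos).1 (hs.x_mem n)
  have h1 := hA.inner_nonneg hxA ha
  have h2 := hB₂ (s.x n) p
  have h3 := hB₃.inner_nonneg (hs.c_mem n) hb
  have hmono : 0 ≤ inner ℝ (s.x n - p) ((s.γ n)⁻¹ • (s.z n - s.x n) - B₁ (s.z n)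
      - (B₂ (s.z n) + s.b n) + (B₂ (s.x n) + s.c n) + B₁ p) := by
    have e : (s.γ n)⁻¹ • (s.z n - s.x n) - B₁ (s.z n)
        - (B₂ (s.z n) + s.b n) + (B₂ (s.x n) + s.c n) + B₁ p
        = ((s.γ n)⁻¹ • (s.z n - s.x n) - (B₁ (s.z n) + B₂ (s.z n) + s.b n) - a)
          + (B₂ (s.x n) - B₂ p) + (s.c n - b) + (a + B₁ p + B₂ p + b) := by abel
    rw [e, hab, add_zero, inner_add_right, inner_add_right]
    linarith
  have hκ : s.γ n * ‖(B₂ (s.z n) + s.b n) - (B₂ (s.x n) + s.c n)‖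
      ≤ (L * ρ * σ + θ) * ‖s.z n - s.x n‖ := by
    have h4 := hs.mul_norm_sub_le hA hf hρ hσ n
    have h5 := hB₂L (s.z n) (s.x n)
    have hρσ := (mul_pos hρ hσ.1).le
    rw [add_sub_add_comm]
    calc s.γ n * ‖(B₂ (s.z n) - B₂ (s.x n)) + (s.b n - s.c n)‖
        ≤ s.γ n * (‖B₂ (s.z n) - B₂ (s.x n)‖ + ‖s.b n - s.c n‖) := by
          gcongr
          exact norm_add_le _ _
      _ = s.γ n * ‖B₂ (s.z n) - B₂ (s.x n)‖ + s.γ n * ‖s.b n - s.c n‖ := mul_add _ _ _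
      _ ≤ ρ * σ * (L * ‖s.z n - s.x n‖) + θ * ‖s.z n - s.x n‖ := by gcongr
      _ = _ := by ring
  have hγβ : s.γ n ≤ 2 * β * ε :=
    hle.trans ((mul_le_of_le_one_right hρ.le hσ.2.le).trans hρβ)
  refine le_trans ?_ (hB₁.norm_forward_sub_sq_le hε hpos hγβ hmono hκ)
  have h6 := (hs.z_succ n).norm_sub_le hX hpX
  rw [add_sub_assoc, ← smul_sub] at h6
  gcongr

/-! ### Weak cluster points are solutions -/

/-- Let `x i = J_{γ i A} (z i - γ i (B₁ z i + B₂ z i + b i))`. If `z i` converges weakly to `p` and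
the residuals tend to `0`, then `p` is a solution. -/
theorem isInclusionSolution_of_tendsto [CompleteSpace H] {β L : ℝ} (hβ : 0 < β)
    (hB₁ : IsCocoercive β B₁) (hB₂ : IsMonotoneMap B₂)
    (hB₂L : ∀ x y, ‖B₂ x - B₂ y‖ ≤ L * ‖x - y‖)
    (hAB₃ : IsMaximallyMonotone fun x => A x + B₃ x) {ι : Type*} {l : Filter ι} [l.NeBot]
    {z x b c : ι → H} {γ : ι → ℝ} {p : H} {R : ℝ} (hpX : p ∈ X) (hR : ∀ᶠ i in l, ‖z i‖ ≤ R)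
    (hz : ∀ y, Tendsto (fun i => inner ℝ (z i) y) l (𝓝 (inner ℝ p y)))
    (hx : ∀ᶠ i in l, (γ i)⁻¹ • (z i - x i) - (B₁ (z i) + B₂ (z i) + b i) ∈ A (x i))
    (hc : ∀ᶠ i in l, c i ∈ B₃ (x i)) (hzx : Tendsto (fun i => z i - x i) l (𝓝 0))
    (hq : Tendsto (fun i => (γ i)⁻¹ • (z i - x i)) l (𝓝 0))
    (hbc : Tendsto (fun i => b i - c i) l (𝓝 0)) : IsInclusionSolution X A B₁ B₂ B₃ p := by
  have hlip : ∀ {B : H → H} {K : ℝ}, (∀ x y, ‖B x - B y‖ ≤ K * ‖x - y‖) →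
      Tendsto (fun i => B (z i) - B (x i)) l (𝓝 0) := fun {B K} hB =>
    squeeze_zero_norm (fun i => hB (z i) (x i)) (by simpa using hzx.norm.const_mul K)
  have hB₁L := hB₁.norm_sub_le hβ
  let e : ι → H := fun i => (γ i)⁻¹ • (z i - x i) - (B₁ (z i) - B₁ (x i))
    - (B₂ (z i) - B₂ (x i)) - (b i - c i)
  have he : Tendsto e l (𝓝 0) := by
    simpa using ((hq.sub (hlip hB₁L)).sub (hlip hB₂L)).sub hbc
  have hxw : ∀ y, Tendsto (fun i => inner ℝ (x i) y) l (𝓝 (inner ℝ p y)) := by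
    intro y
    have h := (hz y).sub (hzx.inner (𝕜 := ℝ) (tendsto_const_nhds (x := y)))
    simpa [← inner_sub_left] using h
  have hxR : ∀ᶠ i in l, ‖x i‖ ≤ R + 1 := by
    have h0 : Tendsto (fun i => ‖z i - x i‖) l (𝓝 0) := by simpa using hzx.norm
    filter_upwards [hR, h0.eventually_lt_const one_pos] with i h1 h2
    have h3 := norm_sub_le (z i) (z i - x i)
    rw [sub_sub_cancel] at h3
    linarith
  have hneg : -(B₁ p + B₂ p) ∈ A p + B₃ p := by
    refine hAB₃.neg_mem_of_forall_inner_nonneg (C := fun x => B₁ x + B₂ x) (K := β⁻¹ + L)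
      (fun x y => ?_) fun y v hv => ?_
    · rw [add_sub_add_comm, add_mul]
      exact (norm_add_le _ _).trans (add_le_add (hB₁L x y) (hB₂L x y))
    · have hlim := (tendsto_inner_of_weak_of_strong hxR hxw
        (he.sub_const (v + (B₁ y + B₂ y)))).sub
        ((tendsto_const_nhds (x := y)).inner (𝕜 := ℝ) (he.sub_const (v + (B₁ y + B₂ y))))
      rw [zero_sub, ← inner_sub_left] at hlim
      refine ge_of_tendsto hlim ?_
      filter_upwards [hx, hc] with i hi hci
      have h1 := hAB₃.inner_nonneg (Set.add_mem_add hi hci) hv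
      have h2 : 0 ≤ inner ℝ (x i - y) (B₁ (x i) - B₁ y) :=
        le_trans (by positivity) (hB₁ (x i) y)
      have h3 := hB₂ (x i) y
      have e' : e i - (v + (B₁ y + B₂ y)) = ((γ i)⁻¹ • (z i - x i)
          - (B₁ (z i) + B₂ (z i) + b i) + c i - v) + (B₁ (x i) - B₁ y) + (B₂ (x i) - B₂ y) := by
        simp only [e]; abel
      rw [← inner_sub_left, e', inner_add_right, inner_add_right]
      linarith
  obtain ⟨a, ha, b', hb', hab⟩ := hneg
  refine isInclusionSolution_iff.2 ⟨hpX, a, ha, b', hb', ?_⟩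
  have : a + B₁ p + B₂ p + b' = (a + b') + (B₁ p + B₂ p) := by abel
  rw [this, show a + b' = _ from hab, neg_add_cancel]

/-- A step size smaller than `ρ σ` was preceded by a failed test, at the step size `γ n / σ`. -/
theorem IsFBHF.not_lineSearchTest {ρ σ θ : ℝ} (hρ : 0 < ρ) (hσ : σ ∈ Set.Ioo (0 : ℝ) 1)
    {s : FBHFSequences H} (hs : IsFBHF X A B₁ B₂ B₃ ρ σ θ s) {n : ℕ} (hn : s.γ n < ρ * σ) :
    ¬ LineSearchTest A B₁ B₂ B₃ θ (s.z n) (s.b n) (s.γ n / σ) := by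
  intro htest
  obtain ⟨k, hk, h⟩ := hs.exists_pow n
  obtain ⟨j, rfl⟩ : ∃ j, k = j + 2 := by
    refine ⟨k - 2, ?_⟩
    have : k ≠ 1 := by rintro rfl; rw [h, pow_one] at hn; exact lt_irrefl _ hn
    omega
  have h1 : s.γ n / σ = ρ * σ ^ (j + 1) := by
    rw [h, div_eq_iff hσ.1.ne']; ring
  have h2 := (hs.step_size n).2 ⟨⟨j + 1, by omega, h1⟩, htest⟩
  rw [div_le_iff₀ hσ.1] at h2
  have := hs.step_pos hρ hσ n
  nlinarith [hσ.2]

/-- When the step sizes are smaller than `ρ σ` and `B₃` is uniformly continuous in weakly compact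
sets, the failed tests, at the step sizes `γ n / σ`, provide points with vanishing residuals. -/
theorem IsFBHF.isInclusionSolution_of_step_lt [CompleteSpace H] {β L ρ σ θ : ℝ}
    (hA : IsMaximallyMonotone A) (hβ : 0 < β)
    (hB₁ : IsCocoercive β B₁) (hB₂ : IsMonotoneMap B₂)
    (hB₂L : ∀ x y, ‖B₂ x - B₂ y‖ ≤ L * ‖x - y‖) (hdom : opDom A ∪ X ⊆ opDom B₃)
    (hAB₃ : IsMaximallyMonotone fun x => A x + B₃ x) (hρ : 0 < ρ)
    (hσ : σ ∈ Set.Ioo (0 : ℝ) 1) (hθ : 0 < θ)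
    (huc : ∀ K ⊆ closedConvexHull ℝ (opDom A ∪ X),
      IsCompact (toWeakSpace ℝ H '' K) → IsUniformlyContinuousIn B₃ K)
    {s : FBHFSequences H} (hs : IsFBHF X A B₁ B₂ B₃ ρ σ θ s) {R : ℝ} (hR : ∀ n, ‖s.z n‖ ≤ R)
    (hzx : Tendsto (fun n => s.z n - s.x n) atTop (𝓝 0)) {l : Filter ℕ} [l.NeBot]
    (hl : l ≤ atTop) {p : H} (hpX : p ∈ X) (hzX : ∀ᶠ n in l, s.z n ∈ X)
    (hz : ∀ y, Tendsto (fun n => inner ℝ (s.z n) y) l (𝓝 (inner ℝ p y)))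
    (hlt : ∀ᶠ n in l, s.γ n < ρ * σ) : IsInclusionSolution X A B₁ B₂ B₃ p := by
  have hγ : ∀ n, 0 < s.γ n / σ := fun n => div_pos (hs.step_pos hρ hσ n) hσ.1
  choose x hx using fun n => hA.exists_mem_resolventOp (hγ n)
    (s.z n - (s.γ n / σ) • (B₁ (s.z n) + B₂ (s.z n) + s.b n))
  have hxdom : ∀ n, x n ∈ opDom A := fun n => mem_opDom_of_mem_resolventOp (hx n)
  choose c hc using fun n => hdom (Or.inl (hxdom n))
  have hxA := fun n => (mem_resolventOp_smul_iff (hγ n)).1 (hx n)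
  have hle : ∀ n, ‖s.z n - x n‖ ≤ σ⁻¹ * ‖s.z n - s.x n‖ := by
    intro n
    have hpos := hs.step_pos hρ hσ n
    have h := hA.norm_sub_div_le hpos ((le_div_iff₀ hσ.1).2
      (mul_le_of_le_one_right hpos.le hσ.2.le)) (hxA n)
      ((mem_resolventOp_smul_iff hpos).1 (hs.x_mem n))
    rw [div_div_eq_mul_div, div_le_div_iff_of_pos_right hpos] at h
    rwa [← div_eq_inv_mul, le_div_iff₀ hσ.1]
  have hzx' : Tendsto (fun n => s.z n - x n) atTop (𝓝 0) :=
    squeeze_zero_norm hle (by simpa using hzx.norm.const_mul σ⁻¹)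
  have hnorm : Tendsto (fun n => ‖s.z n - x n‖) atTop (𝓝 0) := by simpa using hzx'.norm
  have hfail : ∀ᶠ n in l, ‖s.z n - x n‖ / (s.γ n / σ) ≤ θ⁻¹ * ‖s.b n - c n‖ := by
    filter_upwards [hlt] with n hn
    have h := hs.not_lineSearchTest hρ hσ hn
    rw [LineSearchTest] at h
    push Not at h
    have h1 := h (x n) (hx n) (c n) (hc n)
    rw [← div_eq_inv_mul, div_le_div_iff₀ (hγ n) hθ]
    linarith
  -- A weakly compact set that eventually contains the points `z n` and `x n`.
  let K : Set H := closedConvexHull ℝ (opDom A ∪ X) ∩ Metric.closedBall 0 (R + 1)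
  have hK : IsCompact (toWeakSpace ℝ H '' K) :=
    isCompact_toWeakSpace_image
      (convex_closedConvexHull.inter (convex_closedBall _ _))
      (isClosed_closedConvexHull.inter Metric.isClosed_closedBall)
      (R := R + 1) (fun x hx => by simpa using hx.2)
  obtain ⟨f, hf, hfu⟩ := huc K Set.inter_subset_left hK
  have hzK : ∀ᶠ n in l, s.z n ∈ K ∩ opDom B₃ := by
    filter_upwards [hzX] with n hn
    refine ⟨⟨subset_closedConvexHull (Or.inr hn), ?_⟩, _, hs.b_mem n⟩
    simpa using (hR n).trans (by linarith)
  have hxK : ∀ᶠ n in l, x n ∈ K ∩ opDom B₃ := by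
    filter_upwards [hl (hnorm.eventually_lt_const one_pos)] with n hn
    refine ⟨⟨subset_closedConvexHull (Or.inl (hxdom n)), ?_⟩, _, hc n⟩
    have h1 := norm_sub_le (s.z n) (s.z n - x n)
    rw [sub_sub_cancel] at h1
    have h2 := hR n
    simp only [Metric.mem_closedBall, dist_zero_right]
    linarith
  have hbc : Tendsto (fun n => s.b n - c n) l (𝓝 0) := by
    rw [Metric.tendsto_nhds]
    intro δ hδ
    obtain ⟨η, hη, h⟩ := Metric.uniformContinuousOn_iff.1 hfu δ hδ
    filter_upwards [hzK, hxK, hl (hnorm.eventually_lt_const hη)] with n h1 h2 h3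
    have hb := hs.b_mem n
    have hc := hc n
    rw [hf _ h1, Set.mem_singleton_iff] at hb
    rw [hf _ h2, Set.mem_singleton_iff] at hc
    rw [dist_zero_right, hb, hc, ← dist_eq_norm]
    exact h _ h1 _ h2 (by rwa [dist_eq_norm])
  have hq : Tendsto (fun n => (s.γ n / σ)⁻¹ • (s.z n - x n)) l (𝓝 0) := by
    refine squeeze_zero_norm' ?_ (by simpa using hbc.norm.const_mul θ⁻¹)
    filter_upwards [hfail] with n hn
    rwa [norm_inv_smul_sub (hγ n)]
  exact isInclusionSolution_of_tendsto hβ hB₁ hB₂ hB₂L hAB₃ hpX (Eventually.of_forall hR) hz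
    (Eventually.of_forall hxA) (Eventually.of_forall hc) (hzx'.mono_left hl) hq hbc

theorem IsFBHF.isInclusionSolution_of_le_step [CompleteSpace H] {β L ρ σ θ : ℝ} {f : H → H}
    (hA : IsMaximallyMonotone A) (hβ : 0 < β)
    (hB₁ : IsCocoercive β B₁) (hB₂ : IsMonotoneMap B₂)
    (hB₂L : ∀ x y, ‖B₂ x - B₂ y‖ ≤ L * ‖x - y‖) (hf : ∀ x ∈ opDom A ∪ X, B₃ x = {f x})
    (hAB₃ : IsMaximallyMonotone fun x => A x + B₃ x) (hρ : 0 < ρ)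
    (hσ : σ ∈ Set.Ioo (0 : ℝ) 1)
    {s : FBHFSequences H} (hs : IsFBHF X A B₁ B₂ B₃ ρ σ θ s) {R : ℝ} (hR : ∀ n, ‖s.z n‖ ≤ R)
    (hzx : Tendsto (fun n => s.z n - s.x n) atTop (𝓝 0)) {l : Filter ℕ} [l.NeBot]
    (hl : l ≤ atTop) {p : H} (hpX : p ∈ X)
    (hz : ∀ y, Tendsto (fun n => inner ℝ (s.z n) y) l (𝓝 (inner ℝ p y)))
    {δ : ℝ} (hδ : 0 < δ) (hle : ∀ᶠ n in l, δ ≤ s.γ n) : IsInclusionSolution X A B₁ B₂ B₃ p := by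
  have hpos := hs.step_pos hρ hσ
  have hnorm : Tendsto (fun n => ‖s.z n - s.x n‖) l (𝓝 0) := by simpa using (hzx.mono_left hl).norm
  have hq : Tendsto (fun n => (s.γ n)⁻¹ • (s.z n - s.x n)) l (𝓝 0) := by
    refine squeeze_zero_norm' ?_ (by simpa using hnorm.const_mul δ⁻¹)
    filter_upwards [hle] with n hn
    rw [norm_inv_smul_sub (hpos n), ← div_eq_inv_mul]
    gcongr
  have hbc : Tendsto (fun n => s.b n - s.c n) l (𝓝 0) := by
    refine squeeze_zero_norm (a := fun n => θ * ‖(s.γ n)⁻¹ • (s.z n - s.x n)‖) (fun n => ?_)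
      (by simpa using hq.norm.const_mul θ)
    rw [norm_inv_smul_sub (hpos n), mul_div_assoc', le_div_iff₀ (hpos n), mul_comm]
    exact hs.mul_norm_sub_le hA hf hρ hσ n
  exact isInclusionSolution_of_tendsto hβ hB₁ hB₂ hB₂L hAB₃ hpX (Eventually.of_forall hR) hz
    (Eventually.of_forall fun n => (mem_resolventOp_smul_iff (hpos n)).1 (hs.x_mem n))
    (Eventually.of_forall hs.c_mem) (hzx.mono_left hl) hq hbc

/-- A nonnegative sequence that decreases by at least `η r n` at each step converges, and
`r n → 0`. -/
theorem tendsto_of_le_sub_mul {v r : ℕ → ℝ} {η : ℝ} (hη : 0 < η) (hv : ∀ n, 0 ≤ v n)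
    (hr : ∀ n, 0 ≤ r n) (h : ∀ n, v (n + 1) ≤ v n - η * r n) :
    (∃ d, Tendsto v atTop (𝓝 d)) ∧ Tendsto r atTop (𝓝 0) := by
  have hanti : Antitone v := antitone_nat_of_succ_le fun n => by
    have := h n
    have := mul_nonneg hη.le (hr n)
    linarith
  have hlim : Tendsto v atTop (𝓝 (⨅ n, v n)) :=
    tendsto_atTop_ciInf hanti ⟨0, by rintro _ ⟨n, rfl⟩; exact hv n⟩
  refine ⟨⟨_, hlim⟩, squeeze_zero hr (g := fun n => (v n - v (n + 1)) / η) (fun n => ?_) ?_⟩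
  · rw [le_div_iff₀ hη]
    linarith [h n]
  · simpa using (hlim.sub (hlim.comp (tendsto_add_atTop_nat 1))).div_const η

end

/-! ### Well-posedness and weak convergence -/

theorem theorem3p2 {H : Type*} [NormedAddCommGroup H] [InnerProductSpace ℝ H] [CompleteSpace H]
    (X : Set H) (hX_ne : X.Nonempty) (hX_closed : IsClosed X) (hX_convex : Convex ℝ X)
    (A : H → Set H) (hA : IsMaximallyMonotone A)
    (β : ℝ) (hβ : 0 < β) (B₁ : H → H) (hB₁ : IsCocoercive β B₁)
    (L : ℝ) (hL : 0 < L) (B₂ : H → H) (hB₂ : IsMonotoneMap B₂)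
    (hB₂L : ∀ x y, ‖B₂ x - B₂ y‖ ≤ L * ‖x - y‖)
    (B₃ : H → Set H) (hB₃ : IsMaximallyMonotone B₃)
    (hB₃dom : opDom A ∪ X ⊆ opDom B₃)
    (hB₃cont : IsSingleValuedContinuousIn B₃ (opDom A ∪ X))
    (hAB₃ : IsMaximallyMonotone (fun x => A x + B₃ x))
    (hsol : ∃ x, IsInclusionSolution X A B₁ B₂ B₃ x)
    (hcond : X ⊆ opDom A
      ∨ (closure (opDom A) ⊆ opDom B₃ ∧ IsLocallyBoundedIn B₃ (opDom B₃))
      ∨ closure (opDom A) ⊆ interior (opDom B₃))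
    (ε : ℝ) (hε : ε ∈ Set.Ioo (0 : ℝ) 1)
    (ρ : ℝ) (hρ : ρ = min (2 * β * ε) (Real.sqrt (1 - ε) / L))
    (σ : ℝ) (hσ : σ ∈ Set.Ioo (0 : ℝ) 1)
    (θ : ℝ) (hθ : θ ∈ Set.Ioo (0 : ℝ) (Real.sqrt (1 - ε) - L * ρ * σ))
    (z₀ : H) (hz₀ : z₀ ∈ opDom B₃) :
    -- the iteration is well defined
    ((z₀ ∈ opDom A
        ∨ (closure (opDom A) ⊆ opDom B₃ ∧ IsLocallyBoundedIn B₃ (opDom B₃))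
        ∨ closure (opDom A) ⊆ interior (opDom B₃)) →
      ∀ b₀ ∈ B₃ z₀, ∃! s : FBHFSequences H,
        IsFBHF X A B₁ B₂ B₃ ρ σ θ s ∧ s.z 0 = z₀ ∧ s.b 0 = b₀) ∧
    -- its iterates converge weakly to a solution
    (∀ s : FBHFSequences H, IsFBHF X A B₁ B₂ B₃ ρ σ θ s → s.z 0 = z₀ →
      (0 < Filter.liminf s.γ Filter.atTop
        ∨ ∀ K ⊆ closedConvexHull ℝ (opDom A ∪ X),
            IsCompact (toWeakSpace ℝ H '' K) → IsUniformlyContinuousIn B₃ K) →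
      ∃ x, IsInclusionSolution X A B₁ B₂ B₃ x ∧
        Filter.Tendsto (fun n => toWeakSpace ℝ H (s.z n)) Filter.atTop
          (nhds (toWeakSpace ℝ H x))) := by
  obtain ⟨f, hf, hfc⟩ := hB₃cont
  have h1ε : 0 < Real.sqrt (1 - ε) := Real.sqrt_pos.2 (by linarith [hε.2])
  have hρpos : 0 < ρ := by
    rw [hρ]
    exact lt_min (mul_pos (mul_pos two_pos hβ) hε.1) (div_pos h1ε hL)
  have hρβ : ρ ≤ 2 * β * ε := hρ ▸ min_le_left _ _
  constructor
  · intro hstart b₀ hb₀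
    have hlb : (closure (opDom A) ⊆ opDom B₃ ∧ IsLocallyBoundedIn B₃ (opDom B₃)) ∨
        closure (opDom A) ⊆ interior (opDom B₃) → IsLocallyBoundedIn B₃ (closure (opDom A)) := by
      rintro (⟨h, hloc⟩ | h) x hx
      · exact hloc x (h hx)
      · exact hB₃.exists_isBounded_of_mem_interior (h hx)
    have hls : ∀ {z b : H}, b ∈ B₃ z →
        (z ∈ opDom A ∨ IsLocallyBoundedIn B₃ (closure (opDom A))) →
        ∃ k : ℕ, 1 ≤ k ∧ LineSearchTest A B₁ B₂ B₃ θ z b (ρ * σ ^ k) := fun hb hz =>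
      exists_lineSearchTest hA (fun x hx => hf x (Or.inl hx))
        (hfc.mono Set.subset_union_left) hρpos hσ hθ.1 hb hz
    obtain ⟨s, hs, hsz, hsb⟩ := exists_isFBHF hX_ne hX_closed hX_convex hA hB₃dom hρpos hσ hb₀
      (hls hb₀ (hstart.imp_right hlb)) fun z hz b hb => hls hb
        (hcond.imp (fun h => h hz) hlb)
    exact ⟨s, ⟨hs, hsz, hsb⟩, fun t ht => ht.1.unique hX_convex hA hf hρpos hσ hs
      (ht.2.1.trans hsz.symm) (ht.2.2.trans hsb.symm)⟩
  · rintro s hs - hstep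
    set η := 1 - ε - (L * ρ * σ + θ) ^ 2 with hηdef
    have hη : 0 < η := by
      have h0 : 0 ≤ L * ρ * σ + θ := by
        have := mul_pos (mul_pos hL hρpos) hσ.1
        linarith [hθ.1]
      have h1 : (L * ρ * σ + θ) ^ 2 < 1 - ε :=
        (Real.lt_sqrt h0).1 (by linarith [hθ.2])
      linarith
    have hfejer : ∀ p, IsInclusionSolution X A B₁ B₂ B₃ p → ∀ n,
        ‖s.z (n + 1) - p‖ ^ 2 ≤ ‖s.z n - p‖ ^ 2 - η * ‖s.z n - s.x n‖ ^ 2 := fun p hp n =>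
      hs.norm_sub_sq_le hX_convex hA hB₁ hB₂ hB₂L hB₃ hf hε.1 hρpos hρβ hσ hp n
    have hconv : ∀ p, IsInclusionSolution X A B₁ B₂ B₃ p →
        (∃ d, Filter.Tendsto (fun n => ‖s.z n - p‖ ^ 2) Filter.atTop (nhds d)) ∧
        Filter.Tendsto (fun n => ‖s.z n - s.x n‖ ^ 2) Filter.atTop (nhds 0) := fun p hp =>
      tendsto_of_le_sub_mul hη (fun _ => sq_nonneg _) (fun _ => sq_nonneg _) (hfejer p hp)
    obtain ⟨p₀, hp₀⟩ := hsol
    have hzx : Filter.Tendsto (fun n => s.z n - s.x n) Filter.atTop (nhds 0) := by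
      rw [tendsto_zero_iff_norm_tendsto_zero]
      simpa using (hconv p₀ hp₀).2.sqrt
    have hR : ∀ n, ‖s.z n‖ ≤ ‖s.z 0 - p₀‖ + ‖p₀‖ := by
      intro n
      have hanti : Antitone fun n => ‖s.z n - p₀‖ ^ 2 := antitone_nat_of_succ_le fun n => by
        have := hfejer p₀ hp₀ n
        have := mul_nonneg hη.le (sq_nonneg ‖s.z n - s.x n‖)
        linarith
      have h1 : ‖s.z n - p₀‖ ≤ ‖s.z 0 - p₀‖ :=
        le_of_sq_le_sq (hanti (Nat.zero_le n)) (norm_nonneg _)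
      have h2 := norm_add_le (s.z n - p₀) p₀
      rw [sub_add_cancel] at h2
      linarith
    have hzX : ∀ᶠ n in Filter.atTop, s.z n ∈ X := by
      filter_upwards [Filter.eventually_ge_atTop 1] with n hn
      obtain ⟨m, rfl⟩ := Nat.exists_eq_add_of_le' hn
      exact (hs.z_succ m).1
    obtain ⟨p, hp, hlim⟩ := exists_tendsto_inner_of_opial (l := Filter.atTop)
      (S := {p | IsInclusionSolution X A B₁ B₂ B₃ p}) (Filter.Eventually.of_forall hR)
      (fun p hp => (hconv p hp).1) fun U hU p hUp => by
        have hpX : p ∈ X := hX_convex.mem_of_tendsto_inner hX_closed (hU hzX) hUp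
        rcases hstep with hinf | huc
        · obtain ⟨δ, hδ, hδlt⟩ := exists_between hinf
          have hev : ∀ᶠ n in Filter.atTop, δ < s.γ n := Filter.eventually_lt_of_lt_liminf hδlt
            ⟨0, Filter.eventually_map.2
              (Filter.Eventually.of_forall fun n => (hs.step_pos hρpos hσ n).le)⟩
          exact hs.isInclusionSolution_of_le_step hA hβ hB₁ hB₂ hB₂L hf hAB₃ hρpos hσ hR hzx hU
            hpX hUp hδ (hU (hev.mono fun n hn => hn.le))
        -- Along the ultrafilter, either the first trial step size is accepted, or it is rejected.
        · rcases U.em fun n => s.γ n < ρ * σ with hlt | hge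
          · exact hs.isInclusionSolution_of_step_lt hA hβ hB₁ hB₂ hB₂L hB₃dom hAB₃ hρpos hσ hθ.1
              huc hR hzx hU hpX (hU hzX) hUp hlt
          · exact hs.isInclusionSolution_of_le_step hA hβ hB₁ hB₂ hB₂L hf hAB₃ hρpos hσ hR hzx
              hU hpX hUp (mul_pos hρpos hσ.1) (hge.mono fun n hn => not_lt.1 hn)
    exact ⟨p, hp, tendsto_toWeakSpace_iff.2 hlim⟩
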